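/- Let $\mathbf T=(T_1,T_2)$ be a 2-variable weighted shift of bounded operators on $\ell^2(\mathbb Z_+^2)$, $T_1e_{\mathbf k}=\alpha_{\mathbf k}e_{\mathbf k+(1,0)}$, $T_2e_{\mathbf k}=\beta_{\mathbf k}e_{\mathbf k+(0,1)}$, where $e_{\mathbf k}$ is the canonical orthonormal basis. The weights are determined by $a>0$ and positive sequences $(x_n)_{n\ge0},(y_n)_{n\ge0},(\alpha_n)_{n\ge1},(\beta_n)_{n\ge1}$ as follows: $$\alpha_{(k_1,0)}=x_{k_1},\qquad \alpha_{(0,k_2)}=a\prod_{j=1}^{k_2-1}\frac{\beta_j}{y_j}\ (k_2\ge1),\qquad \alpha_{(k_1,k_2)}=\alpha_{k_1}\ (k_1,k_2\ge1),$$ $$\beta_{(0,k_2)}=y_{k_2},\qquad \beta_{(k_1,0)}=\frac{a\,y_0}{x_0}\prod_{i=1}^{k_1-1}\frac{\alpha_i}{x_i}\ (k_1\ge1),\qquad \beta_{(k_1,k_2)}=\beta_{k_2}\ (k_1,k_2\ge1).$$ (So the restriction of $\mathbf T$ to the span of the $e_{\mathbf k}$ with $k_1,k_2\ge1$ is of tensor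 form.) Assume that $T_1$ and $T_2$ commute and that each of them is subnormal. The Berger measure of a subnormal weighted shift $\mathrm{shift}(w_0,w_1,\dots)$ is the probability measure on $[0,\sup_n w_n^2]$ whose $n$-th moment is $w_0^2\cdots w_{n-1}^2$ for every $n\ge0$. Let $\xi_x,\eta_y,(\eta_y)_1,\xi,\eta$ be the Berger measures of $\mathrm{shift}(x_0,x_1,\dots)$, $\mathrm{shift}(y_0,y_1,\dots)$, $\mathrm{shift}(y_1,y_2,\dots)$, $\mathrm{shift}(\alpha_1,\alpha_2,\dots)$, $\mathrm{shift}(\beta_1,\beta_2,\dots)$ respectively, and let $\frac1s\in L^1(\xi)$ and $\frac1t\in L^1(\eta)$. For a finite signed measure $\nu$ on $\mathbb R$ with $\frac1s\in L^1(|\nu|)$ put $\|\frac1s\|_{L^1(\nu)}=\int|\frac1s|\,d|\nu|(s)$ and $d\widetilde\nu(s)=\frac{1}{s\,\|1/s\|_{L^1(\nu)}}\,d\nu(s)$, with $\widetilde\nu=0$ if $\nu=0$. Let $\delta_0$ be the unit point mass at $0$, and define the signed measures $$\psi=(\eta_y)_1-a^2\left\|\tfrac1s\right\|_{L^1(\xi)}\eta,\qquad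 \varphi=\xi_x-y_0^2\left\|\tfrac1t\right\|_{L^1(\psi)}\delta_0-a^2y_0^2\left\|\tfrac1s\right\|_{L^1(\xi)}\left\|\tfrac1t\right\|_{L^1(\eta)}\widetilde\xi .$$ Then $\mathbf T$ is subnormal (that is, $\mathbf T$ is the restriction of a commuting pair of normal operators to a common invariant subspace) if and only if $\psi$ and $\varphi$ are positive measures. In that case $\mathbf T$ has a Berger measure, that is, a probability measure $\mu$ on $[0,\|T_1\|^2]\times[0,\|T_2\|^2]$ such that $\int s^{k_1}t^{k_2}\,d\mu(s,t)$ equals $$\prod_{i=0}^{k_1-1}\alpha_{(i,0)}^2\ \prod_{j=0}^{k_2-1}\beta_{(k_1,j)}^2\qquad\text{for all }k_1,k_2\ge0,$$ and every such $\mu$ is given by $$\mu=\varphi\times(\delta_0-\widetilde\eta)+y_0^2\left\|\tfrac1t\right\|_{L^1(\psi)}\delta_0\times(\widetilde\psi-\widetilde\eta)+\xi_x\times\widetilde\eta .$$ -/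

import Mathlib

open MeasureTheory

noncomputable section

namespace BergerTC

/-! ### Subnormal operators and subnormal pairs -/

/-- `T` is subnormal: up to an isometric embedding `V` of its space into a Hilbert space `K`, it is
the restriction of a normal operator on `K` to an invariant subspace (the range of `V`). -/
def IsSubnormal.{u} {H : Type u} [NormedAddCommGroup H] [InnerProductSpace ℂ H]
    (T : H →L[ℂ] H) : Prop :=
  ∃ (K : Type u) (_ : NormedAddCommGroup K) (_ : InnerProductSpace ℂ K) (_ : CompleteSpace K)
    (V : H →ₗᵢ[ℂ] K) (N : K →L[ℂ] K), IsStarNormal N ∧ ∀ h, N (V h) = V (T h)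

/-- The pair `(T₁, T₂)` is (jointly) subnormal: it is the restriction of a commuting pair of normal
operators to a common invariant subspace. -/
def IsSubnormalPair.{u} {H : Type u} [NormedAddCommGroup H] [InnerProductSpace ℂ H]
    (T₁ T₂ : H →L[ℂ] H) : Prop :=
  ∃ (K : Type u) (_ : NormedAddCommGroup K) (_ : InnerProductSpace ℂ K) (_ : CompleteSpace K)
    (V : H →ₗᵢ[ℂ] K) (N₁ N₂ : K →L[ℂ] K),
    IsStarNormal N₁ ∧ IsStarNormal N₂ ∧ Commute N₁ N₂ ∧
      ∀ h, N₁ (V h) = V (T₁ h) ∧ N₂ (V h) = V (T₂ h)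

/-- The class `𝔥₀`: commuting pairs of subnormal operators. -/
def IsCommutingPairOfSubnormals {H : Type*} [NormedAddCommGroup H] [InnerProductSpace ℂ H]
    (T₁ T₂ : H →L[ℂ] H) : Prop :=
  Commute T₁ T₂ ∧ IsSubnormal T₁ ∧ IsSubnormal T₂

/-! ### One- and two-variable weighted shifts, moments, Berger measures -/

/-- The Hilbert space `ℓ²(ℤ₊²)`. -/
abbrev Ell2 : Type := lp (fun _ : ℕ × ℕ => ℂ) 2

/-- The canonical orthonormal basis vector `e_k` of `ℓ²(ℤ₊²)`. -/
def e (k : ℕ × ℕ) : Ell2 := lp.single 2 k (1 : ℂ)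

/-- The bounded operators `T₁, T₂` form the 2-variable weighted shift with weights `A, B`:
`T₁ e_k = A_k e_{k+ε₁}` and `T₂ e_k = B_k e_{k+ε₂}`. -/
def IsTwoVarShift (A B : ℕ × ℕ → ℝ) (T₁ T₂ : Ell2 →L[ℂ] Ell2) : Prop :=
  ∀ k, T₁ (e k) = (A k : ℂ) • e (k + (1, 0)) ∧ T₂ (e k) = (B k : ℂ) • e (k + (0, 1))

/-- The moments `w₀² ⋯ w_{n-1}²` of a one-variable weighted shift. -/
def moment (w : ℕ → ℝ) (n : ℕ) : ℝ := ∏ i ∈ Finset.range n, w i ^ 2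

/-- The moments of a 2-variable weighted shift, computed along the path that goes first in the
horizontal and then in the vertical direction. -/
def moment₂ (A B : ℕ × ℕ → ℝ) (k : ℕ × ℕ) : ℝ :=
  (∏ i ∈ Finset.range k.1, A (i, 0) ^ 2) * ∏ j ∈ Finset.range k.2, B (k.1, j) ^ 2

/-- `ν` is the Berger measure of `shift(w₀, w₁, …)`: a probability measure on `[0, ‖W‖²]`, where
`‖W‖² = sup wₙ²`, whose moments are the moments of the shift. -/
def IsBergerMeasure (w : ℕ → ℝ) (ν : ProbabilityMeasure ℝ) : Prop :=
  (ν : Measure ℝ) (Set.Icc 0 (⨆ n, w n ^ 2))ᶜ = 0 ∧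
    ∀ n, moment w n = ∫ s, s ^ n ∂(ν : Measure ℝ)

/-- `μ` is the Berger measure of the 2-variable weighted shift `(T₁, T₂)` with weights `A, B`:
a probability measure on `[0, ‖T₁‖²] × [0, ‖T₂‖²]` whose moments are those of the shift. -/
def IsBergerMeasure₂ (A B : ℕ × ℕ → ℝ) (T₁ T₂ : Ell2 →L[ℂ] Ell2)
    (μ : ProbabilityMeasure (ℝ × ℝ)) : Prop :=
  (μ : Measure (ℝ × ℝ)) (Set.Icc 0 (‖T₁‖ ^ 2) ×ˢ Set.Icc 0 (‖T₂‖ ^ 2))ᶜ = 0 ∧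
    ∀ k : ℕ × ℕ, moment₂ A B k = ∫ p, p.1 ^ k.1 * p.2 ^ k.2 ∂(μ : Measure (ℝ × ℝ))

/-! ### The weight diagram

The bottom row is `x₀, x₁, …`, the left column is `y₀, y₁, …`, the weight from `(0,1)` to `(1,1)`
is `a`, and the core (indices `k₁, k₂ ≥ 1`) has horizontal weights `α_{k₁}` and vertical weights
`β_{k₂}`. Commutativity determines all the other weights. The values `α 0`, `β 0` are not used. -/

/-- Horizontal weights `α_{(k₁,k₂)}`. -/
def horizontalWeight (a : ℝ) (x y α β : ℕ → ℝ) : ℕ × ℕ → ℝ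
  | (k₁, 0) => x k₁
  | (0, k₂ + 1) => a * ∏ j ∈ Finset.range k₂, β (j + 1) / y (j + 1)
  | (k₁ + 1, _ + 1) => α (k₁ + 1)

/-- Vertical weights `β_{(k₁,k₂)}`. -/
def verticalWeight (a : ℝ) (x y α β : ℕ → ℝ) : ℕ × ℕ → ℝ
  | (0, k₂) => y k₂
  | (k₁ + 1, 0) => a * y 0 / x 0 * ∏ i ∈ Finset.range k₁, α (i + 1) / x (i + 1)
  | (_ + 1, k₂ + 1) => β (k₂ + 1)

/-! ### Operations on measures -/

/-- A positive measure regarded as a signed measure. -/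
def signed {X : Type*} [MeasurableSpace X] (ν : ProbabilityMeasure X) : SignedMeasure X :=
  (ν : Measure X).toSignedMeasure

/-- The unit point mass at `0`. -/
def delta0 : SignedMeasure ℝ := (Measure.dirac (0 : ℝ)).toSignedMeasure

/-- `1/s ∈ L¹(ν)`, where `1/0 = ∞` (so there is no atom at `0`). -/
def InvIntegrable (ν : Measure ℝ) : Prop := ν {0} = 0 ∧ Integrable (fun s => 1 / s) ν

/-- `‖1/s‖_{L¹(ν)}`, the integral of `|1/s|` with respect to the variation of `ν` (which is `ν`
itself if `ν` is positive). -/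
def invNorm (ν : SignedMeasure ℝ) : ℝ := ∫ s, |1 / s| ∂ν.variation

/-- The measure `ν̃`, given by `dν̃(s) = dν(s) / (s ‖1/s‖_{L¹(ν)})`; it is `0` for `ν = 0`. -/
def tilde (ν : SignedMeasure ℝ) : SignedMeasure ℝ :=
  ν.withDensity (fun s => 1 / (s * invNorm ν)) (ContinuousLinearMap.mul ℝ ℝ)

/-- The product of two signed measures on the line. -/
def prodMeas (ν ρ : SignedMeasure ℝ) : SignedMeasure (ℝ × ℝ) :=
  ν.prod ρ (ContinuousLinearMap.mul ℝ ℝ)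

/-- `ψ = (η_y)₁ - a² ‖1/s‖_{L¹(ξ)} η`. -/
def psi (a : ℝ) (ηy₁ ξ η : SignedMeasure ℝ) : SignedMeasure ℝ :=
  ηy₁ - (a ^ 2 * invNorm ξ) • η

/-- `φ = ξ_x - y₀² ‖1/t‖_{L¹(ψ)} δ₀ - a² y₀² ‖1/s‖_{L¹(ξ)} ‖1/t‖_{L¹(η)} ξ̃`. -/
def phi (a y₀ : ℝ) (ξx ψ ξ η : SignedMeasure ℝ) : SignedMeasure ℝ :=
  ξx - (y₀ ^ 2 * invNorm ψ) • delta0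
    - (a ^ 2 * y₀ ^ 2 * invNorm ξ * invNorm η) • tilde ξ

/-- `φ × (δ₀ - η̃) + y₀² ‖1/t‖_{L¹(ψ)} δ₀ × (ψ̃ - η̃) + ξ_x × η̃`. -/
def reconstructed (y₀ : ℝ) (φ ψ ξx η : SignedMeasure ℝ) : SignedMeasure (ℝ × ℝ) :=
  prodMeas φ (delta0 - tilde η)
    + (y₀ ^ 2 * invNorm ψ) • prodMeas delta0 (tilde ψ - tilde η)
    + prodMeas ξx (tilde η)

end BergerTC

end

noncomputable section

namespace BergerTC

/-! The proof has an operator-theoretic half and a measure-theoretic half, joined by the moments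
$\gamma_k$ of the shift.

Operator theory: a commuting 2-variable shift is subnormal exactly when the $\gamma_k$ are the
moments of a compactly supported measure on the closed positive quadrant. Given a normal extension
$(N_1,N_2)$, the measure is the joint distribution of $N_1^*N_1$ and $N_2^*N_2$ in the state of
$e_{(0,0)}$ (`IsSubnormalPair.exists_measure`). Given the measure $\mu$, the shift is modelled by
multiplication by $\sqrt s\,e^{i\theta_1}$ and $\sqrt t\,e^{i\theta_2}$ on $L^2$ of $\mu$ times the
uniform measure in the angles (`isSubnormalPair_of_measure`).

Measure theory: bounded support makes the moment problem determinate, so for this weight diagram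
$\mu$ has the right moments iff its marginals are $\xi_x$ and $\eta_y$ and
$st\,d\mu=a^2y_0^2\,d(\xi\times\eta)$ (`hasProductCore_iff`). Dividing by $st$, the core equation
prescribes $\mu$ on the open quadrant as $a^2y_0^2\,\frac{d\xi}{s}\times\frac{d\eta}{t}$; the only
freedom is on the axes. Let $\Phi$ be the part on the horizontal axis, origin included, and write
the part on the open vertical axis as $y_0^2\,d\Psi(t)/t$. Since $t\,d\eta_y=y_0^2\,d(\eta_y)_1$,
the second marginal condition forces $\Psi=\psi$; the first one then forces $\Phi=\varphi$. Hence
both are positive (`HasProductCore.exists_axisDecomposition`, `IsAxisDecomposition.psi_phi_eq`).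

Conversely, positive $\psi$ and $\varphi$ can be glued to the core, and the result has the required
marginals (`IsAxisDecomposition.hasProductCore_glue`). Eliminating $\widetilde\xi$ from the glued
measure by means of the formula for $\xi_x$ yields the reconstruction formula
(`toSignedMeasure_eq_reconstructed`); determinacy makes it hold for every Berger measure. -/

/-! ### Joint distributions of commuting self-adjoint operators. -/

/-- The Riesz–Markov–Kakutani theorem on a compact space, for functionals that are nonnegative on
squares. -/
lemma exists_measure_of_nonneg_on_squares {X : Type*} [TopologicalSpace X] [T2Space X]
    [CompactSpace X] [MeasurableSpace X] [BorelSpace X] (L : C(X, ℝ) →ₗ[ℝ] ℝ)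
    (hL : ∀ f, 0 ≤ L (f * f)) :
    ∃ μ : Measure X, IsFiniteMeasure μ ∧ ∀ f : C(X, ℝ), ∫ x, f x ∂μ = L f := by
  have hpos : ∀ f : C(X, ℝ), (∀ x, 0 ≤ f x) → 0 ≤ L f := by
    intro f hf
    let g : C(X, ℝ) := ⟨fun x => Real.sqrt (f x), by fun_prop⟩
    have hg : f = g * g := by
      ext x
      exact (Real.mul_self_sqrt (hf x)).symm
    rw [hg]
    exact hL g
  let Λ : CompactlySupportedContinuousMap X ℝ →ₚ[ℝ] ℝ :=
    { toFun := fun g => L g.toContinuousMap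
      map_add' := fun g g' => L.map_add _ _
      map_smul' := fun c g => L.map_smul _ _
      monotone' := fun g g' h => by
        have := hpos (g'.toContinuousMap - g.toContinuousMap) (fun x => sub_nonneg.2 (h x))
        rw [map_sub] at this
        exact sub_nonneg.1 this }
  refine ⟨RealRMK.rieszMeasure Λ, inferInstance, fun f => ?_⟩
  exact RealRMK.integral_rieszMeasure Λ ⟨f, HasCompactSupport.of_compactSpace _⟩

/-- Two self-adjoint elements of a commutative C⋆-algebra have a joint distribution with respect to
every positive functional. -/
lemma exists_joint_distribution {S : Type*} [CommCStarAlgebra S] (ω : S →ₗ[ℂ] ℂ)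
    (hω : ∀ a, 0 ≤ (ω (star a * a)).re) {a b : S} (ha : IsSelfAdjoint a) (hb : IsSelfAdjoint b) :
    ∃ (μ : Measure (ℝ × ℝ)) (R : ℝ), IsFiniteMeasure μ ∧ μ (Metric.closedBall 0 R)ᶜ = 0 ∧
      ∀ k l : ℕ, ∫ p, p.1 ^ k * p.2 ^ l ∂μ = (ω (a ^ k * b ^ l)).re := by
  let X := WeakDual.characterSpace ℂ S
  let _ : MeasurableSpace X := borel X
  have : BorelSpace X := ⟨rfl⟩
  let G := gelfandStarTransform S
  let J := ContinuousMap.realToRCLikeStarAlgHom X ℂ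
  let L : C(X, ℝ) →ₗ[ℝ] ℝ :=
    { toFun := fun f => (ω (G.symm (J f))).re
      map_add' := fun f g => by simp
      map_smul' := fun c f => by
        have h : J (c • f) = (c : ℂ) • J f := by
          ext x
          simp [J]
        rw [h, map_smul, map_smul]
        simp }
  obtain ⟨ν, hν, hint⟩ := exists_measure_of_nonneg_on_squares L (fun f => by
    have h : IsSelfAdjoint (G.symm (J f)) := by
      have : IsSelfAdjoint (J f) := by
        ext x
        simp [J]
      exact this.map G.symm
    have h2 := hω (G.symm (J f))
    rw [h.star_eq] at h2
    simpa [L] using h2)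
  let A : C(X, ℝ) := ⟨fun x => (G a x).re, by fun_prop⟩
  let B : C(X, ℝ) := ⟨fun x => (G b x).re, by fun_prop⟩
  have hreal : ∀ {c : S}, IsSelfAdjoint c → ∀ x, (((G c x).re : ℝ) : ℂ) = G c x := by
    intro c hc x
    have := congrArg (fun f : C(X, ℂ) => f x) (hc.map G).star_eq
    exact Complex.conj_eq_iff_re.1 this
  have hJA : J A = G a := by
    ext x
    exact hreal ha x
  have hJB : J B = G b := by
    ext x
    exact hreal hb x
  -- The Gelfand transforms of `a` and `b` are real-valued. The joint distribution is the image of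
  -- the Riesz measure under this pair, which is bounded by the larger of the two sup norms because
  -- the plane carries the max norm.
  let F : C(X, ℝ × ℝ) := A.prodMk B
  refine ⟨ν.map F, max ‖A‖ ‖B‖, inferInstance, ?_, fun k l => ?_⟩
  · rw [Measure.map_apply F.continuous.measurable Metric.isClosed_closedBall.measurableSet.compl]
    convert measure_empty (μ := ν)
    ext x
    simp only [Set.mem_preimage, Set.mem_compl_iff, Metric.mem_closedBall, dist_zero_right,
      Set.mem_empty_iff_false, iff_false, not_not]
    exact max_le_max (A.norm_coe_le_norm x) (B.norm_coe_le_norm x)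
  · rw [integral_map F.continuous.measurable.aemeasurable (by fun_prop)]
    refine (hint (A ^ k * B ^ l)).trans ?_
    change (ω (G.symm (J (A ^ k * B ^ l)))).re = _
    rw [map_mul, map_pow, map_pow, hJA, hJB, ← map_pow, ← map_pow, ← map_mul,
      StarAlgEquiv.symm_apply_apply]

open scoped IsMulCommutative in
/-- A commuting pair of self-adjoint operators has a joint distribution in every vector state. -/
lemma exists_joint_distribution_of_commute {K : Type*} [NormedAddCommGroup K]
    [InnerProductSpace ℂ K] [CompleteSpace K] {P Q : K →L[ℂ] K} (hP : IsSelfAdjoint P)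
    (hQ : IsSelfAdjoint Q) (hPQ : Commute P Q) (v : K) :
    ∃ (μ : Measure (ℝ × ℝ)) (R : ℝ), IsFiniteMeasure μ ∧ μ (Metric.closedBall 0 R)ᶜ = 0 ∧
      ∀ k l : ℕ, ∫ p, p.1 ^ k * p.2 ^ l ∂μ = (inner ℂ v ((P ^ k * Q ^ l) v)).re := by
  -- Commuting self-adjoint generators give a commutative star algebra, so Gelfand theory applies to
  -- its norm closure; the vector state restricts to a positive functional there.
  let S₀ : StarSubalgebra ℂ (K →L[ℂ] K) := StarAlgebra.adjoin ℂ {P, Q}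
  let S := S₀.topologicalClosure
  have hclosed : IsClosed (S : Set (K →L[ℂ] K)) := S₀.isClosed_topologicalClosure
  have hcomm : IsMulCommutative S₀ := by
    refine StarAlgebra.isMulCommutative_adjoin ℂ ?_ ?_
    · rintro x (rfl | rfl) y (rfl | rfl)
      exacts [rfl, hPQ.eq, hPQ.eq.symm, rfl]
    · rintro x (rfl | rfl) y (rfl | rfl) <;> simp only [hP.star_eq, hQ.star_eq]
      exacts [hPQ.eq, hPQ.eq.symm]
  let _ : CommRing S := S₀.commRingTopologicalClosure mul_comm
  let _ : CStarAlgebra S := StarSubalgebra.cstarAlgebra S (h_closed := hclosed)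
  let _ : CommCStarAlgebra S := { }
  let ω : S →ₗ[ℂ] ℂ :=
    { toFun := fun x => inner ℂ v ((x : K →L[ℂ] K) v)
      map_add' := fun x y => by simp
      map_smul' := fun c x => by simp }
  have hPS : P ∈ S := S₀.le_topologicalClosure (StarAlgebra.subset_adjoin ℂ _ (by simp))
  have hQS : Q ∈ S := S₀.le_topologicalClosure (StarAlgebra.subset_adjoin ℂ _ (by simp))
  refine exists_joint_distribution (S := S) ω (fun x => ?_) (a := ⟨P, hPS⟩) (b := ⟨Q, hQS⟩)
    (Subtype.ext hP) (Subtype.ext hQ)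
  change 0 ≤ (inner ℂ v (((star (x : K →L[ℂ] K)) * (x : K →L[ℂ] K)) v)).re
  rw [ContinuousLinearMap.star_eq_adjoint, mul_apply_eq_comp,
    ContinuousLinearMap.adjoint_inner_right]
  exact inner_self_nonneg (𝕜 := ℂ)

/-! ### From a normal extension to a representing measure. -/

lemma e_norm (k : ℕ × ℕ) : ‖e k‖ = 1 := by
  rw [e, lp.norm_single (by simp)]
  simp

lemma IsTwoVarShift.pow_apply {A B : ℕ × ℕ → ℝ} {T₁ T₂ : Ell2 →L[ℂ] Ell2}
    (h : IsTwoVarShift A B T₁ T₂) (k : ℕ × ℕ) :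
    (T₂ ^ k.2) ((T₁ ^ k.1) (e (0, 0))) =
      (((∏ i ∈ Finset.range k.1, A (i, 0)) * ∏ j ∈ Finset.range k.2, B (k.1, j) : ℝ) : ℂ) •
        e k := by
  obtain ⟨k, l⟩ := k
  have h1 : (T₁ ^ k) (e (0, 0)) = ((∏ i ∈ Finset.range k, A (i, 0) : ℝ) : ℂ) • e (k, 0) := by
    induction k with
    | zero => simp
    | succ k ih =>
      rw [pow_succ', mul_apply_eq_comp, ih, map_smul, (h _).1, smul_smul,
        Finset.prod_range_succ]
      push_cast
      rfl
  simp only [h1, map_smul]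
  induction l with
  | zero => simp
  | succ l ih =>
    rw [pow_succ', mul_apply_eq_comp, ← map_smul, ih, map_smul, (h _).2, smul_smul,
      Finset.prod_range_succ]
    push_cast
    rw [mul_assoc]
    rfl

/-- The moments of a subnormal 2-variable weighted shift are the moments of a compactly supported
measure. -/
lemma IsSubnormalPair.exists_measure {A B : ℕ × ℕ → ℝ} {T₁ T₂ : Ell2 →L[ℂ] Ell2}
    (hs : IsSubnormalPair T₁ T₂) (h : IsTwoVarShift A B T₁ T₂) :
    ∃ (μ : Measure (ℝ × ℝ)) (R : ℝ), IsFiniteMeasure μ ∧ μ (Metric.closedBall 0 R)ᶜ = 0 ∧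
      ∀ k : ℕ × ℕ, moment₂ A B k = ∫ p, p.1 ^ k.1 * p.2 ^ k.2 ∂μ := by
  obtain ⟨K, _, _, _, V, N₁, N₂, hN₁, hN₂, hN, hV⟩ := hs
  have c₁₁ : Commute (star N₁) N₁ := hN₁.star_comm_self
  have c₂₂ : Commute (star N₂) N₂ := hN₂.star_comm_self
  -- Fuglede's theorem: an operator commuting with a normal operator also commutes with its adjoint.
  have c₁₂ : Commute (star N₁) N₂ := (hN₁.commute_star_right hN.symm).symm
  have c₂₁ : Commute (star N₂) N₁ := (hN₂.commute_star_right hN).symm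
  have cs : Commute (star N₁) (star N₂) := hN.star_star
  obtain ⟨μ, R, hμ, hR, hmom⟩ := exists_joint_distribution_of_commute
    (IsSelfAdjoint.star_mul_self N₁) (IsSelfAdjoint.star_mul_self N₂)
    ((cs.mul_right c₁₂).mul_left (c₂₁.symm.mul_right hN)) (V (e (0, 0)))
  refine ⟨μ, R, hμ, hR, fun k => ?_⟩
  have hV₁ : ∀ n x, (N₁ ^ n) (V x) = V ((T₁ ^ n) x) := by
    intro n
    induction n with
    | zero => simp
    | succ n ih =>
      intro x
      rw [pow_succ', pow_succ', mul_apply_eq_comp, ih, (hV _).1]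
      rfl
  have hV₂ : ∀ n x, (N₂ ^ n) (V x) = V ((T₂ ^ n) x) := by
    intro n
    induction n with
    | zero => simp
    | succ n ih =>
      intro x
      rw [pow_succ', pow_succ', mul_apply_eq_comp, ih, (hV _).2]
      rfl
  -- With $X=N_2^{k_2}N_1^{k_1}$ the mixed power is $X^*X$, so its expectation at $Ve_{(0,0)}$ is
  -- $\|T_2^{k_2}T_1^{k_1}e_{(0,0)}\|^2$, the moment of the shift.
  have hop : (star N₁ * N₁) ^ k.1 * (star N₂ * N₂) ^ k.2 =
      star (N₂ ^ k.2 * N₁ ^ k.1) * (N₂ ^ k.2 * N₁ ^ k.1) := by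
    rw [c₁₁.mul_pow, c₂₂.mul_pow, star_mul, star_pow, star_pow, mul_assoc, mul_assoc,
      ← mul_assoc (N₁ ^ k.1), (c₂₁.symm.pow_pow _ _).eq, mul_assoc, (hN.pow_pow _ _).eq]
  rw [hmom, hop, mul_apply_eq_comp, ContinuousLinearMap.star_eq_adjoint,
    ContinuousLinearMap.adjoint_inner_right, mul_apply_eq_comp, hV₁, hV₂,
    h.pow_apply, V.inner_map_map, inner_self_eq_norm_sq_to_K, norm_smul, e_norm, mul_one,
    Complex.norm_real, moment₂, Finset.prod_pow, Finset.prod_pow, ← mul_pow]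
  generalize (∏ x ∈ Finset.range k.1, A (x, 0)) * ∏ x ∈ Finset.range k.2, B (k.1, x) = r
  change _ = (((‖r‖ : ℝ) : ℂ) ^ 2).re
  rw [← Complex.ofReal_pow, Complex.ofReal_re, Real.norm_eq_abs, sq_abs]

/-! ### From a representing measure to a normal extension: multiplication operators in polar
coordinates. -/

open scoped ComplexConjugate

section MultiplicationOperators

variable {Ω : Type*} [MeasurableSpace Ω] {ν : Measure Ω}

/-- The operator of multiplication by an essentially bounded function on `L²`. -/
def mulOp (g : Lp ℂ ⊤ ν) : Lp ℂ 2 ν →L[ℂ] Lp ℂ 2 ν :=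
  (ContinuousLinearMap.mul ℂ ℂ).holderL ν ⊤ 2 2 g

lemma coeFn_mulOp (g : Lp ℂ ⊤ ν) (f : Lp ℂ 2 ν) :
    mulOp g f =ᵐ[ν] fun x => g x * f x :=
  ContinuousLinearMap.coeFn_holder (r := 2) (ContinuousLinearMap.mul ℂ ℂ) g f

lemma commute_mulOp (g h : Lp ℂ ⊤ ν) : Commute (mulOp g) (mulOp h) := by
  refine ContinuousLinearMap.ext fun f => Lp.ext ?_
  rw [mul_apply_eq_comp, mul_apply_eq_comp]
  filter_upwards [coeFn_mulOp g (mulOp h f), coeFn_mulOp h (mulOp g f), coeFn_mulOp g f,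
    coeFn_mulOp h f] with x h1 h2 h3 h4
  rw [h1, h2, h3, h4]
  ring

lemma star_mulOp (g : Lp ℂ ⊤ ν) : star (mulOp g) = mulOp (star g) := by
  rw [ContinuousLinearMap.star_eq_adjoint, eq_comm, ContinuousLinearMap.eq_adjoint_iff]
  intro f h
  rw [L2.inner_def, L2.inner_def]
  refine integral_congr_ae ?_
  filter_upwards [coeFn_mulOp (star g) f, coeFn_mulOp g h, Lp.coeFn_star g] with x h1 h2 h3
  rw [h1, h2, h3]
  simp
  ring

instance isStarNormal_mulOp (g : Lp ℂ ⊤ ν) : IsStarNormal (mulOp g) :=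
  ⟨by rw [star_mulOp]; exact commute_mulOp _ _⟩

end MultiplicationOperators

lemma integral_conj_fourier_mul (m n : ℤ) :
    ∫ x : UnitAddCircle, fourier n x * conj (fourier m x) ∂AddCircle.haarAddCircle =
      if m = n then 1 else 0 := by
  have h := orthonormal_iff_ite.1 (orthonormal_fourier (T := 1)) m n
  rw [← h]
  exact (ContinuousMap.inner_toLp _ _ _).symm

/-- The space on which a 2-variable weighted shift with Berger measure `μ` is modelled. -/
abbrev PolarSpace : Type := (ℝ × ℝ) × (UnitAddCircle × UnitAddCircle)

/-- The product of a measure in the squared radii with the uniform measure in the angles. -/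
def polarMeasure (μ : Measure (ℝ × ℝ)) : Measure PolarSpace :=
  μ.prod (AddCircle.haarAddCircle.prod AddCircle.haarAddCircle)

instance (μ : Measure (ℝ × ℝ)) [IsFiniteMeasure μ] : IsFiniteMeasure (polarMeasure μ) := by
  unfold polarMeasure
  infer_instance

/-- The monomial `z₁ ^ k₁ * z₂ ^ k₂` in polar coordinates. -/
def polarMonomial (k : ℕ × ℕ) (ω : PolarSpace) : ℂ :=
  ((√ω.1.1 ^ k.1 * √ω.1.2 ^ k.2 : ℝ) : ℂ) * (fourier k.1 ω.2.1 * fourier k.2 ω.2.2)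

lemma polarMonomial_add (k l : ℕ × ℕ) (ω : PolarSpace) :
    polarMonomial (k + l) ω = polarMonomial k ω * polarMonomial l ω := by
  simp only [polarMonomial, Prod.fst_add, Prod.snd_add, Nat.cast_add, fourier_add, pow_add]
  push_cast
  ring

lemma continuous_polarMonomial (k : ℕ × ℕ) : Continuous (polarMonomial k) := by
  unfold polarMonomial
  fun_prop

lemma norm_polarMonomial (k : ℕ × ℕ) (ω : PolarSpace) :
    ‖polarMonomial k ω‖ = √ω.1.1 ^ k.1 * √ω.1.2 ^ k.2 := by
  have h : ∀ (n : ℤ) (x : UnitAddCircle), ‖fourier n x‖ = 1 := fun n x => by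
    rw [fourier_apply]
    exact Circle.norm_coe _
  rw [polarMonomial, norm_mul, norm_mul, h, h, mul_one, mul_one, Complex.norm_real,
    Real.norm_of_nonneg (by positivity)]

section

variable {μ : Measure (ℝ × ℝ)} {R : ℝ}

lemma ae_norm_polarMonomial_le (hR : μ (Set.Icc 0 R ×ˢ Set.Icc 0 R)ᶜ = 0) (k : ℕ × ℕ) :
    ∀ᵐ ω ∂polarMeasure μ, ‖polarMonomial k ω‖ ≤ √R ^ k.1 * √R ^ k.2 := by
  have h : ∀ᵐ p ∂μ, p ∈ Set.Icc 0 R ×ˢ Set.Icc 0 R := hR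
  have h' : ∀ᵐ ω ∂polarMeasure μ, ω.1 ∈ Set.Icc 0 R ×ˢ Set.Icc 0 R :=
    Measure.quasiMeasurePreserving_fst.ae h
  filter_upwards [h'] with ω hω
  rw [norm_polarMonomial]
  gcongr
  exacts [hω.1.2, hω.2.2]

lemma memLp_polarMonomial [IsFiniteMeasure μ] (hR : μ (Set.Icc 0 R ×ˢ Set.Icc 0 R)ᶜ = 0) (k : ℕ × ℕ)
    (p : ENNReal) : MemLp (polarMonomial k) p (polarMeasure μ) :=
  (memLp_top_of_bound (continuous_polarMonomial k).aestronglyMeasurable _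
    (ae_norm_polarMonomial_le hR k)).mono_exponent le_top

/-- The angular integrals vanish unless the exponents agree, by orthogonality of characters. When
they agree, the radial factors combine to $s^{k_1}t^{k_2}$, because $\sqrt s\,\sqrt s=s$ on the
support. -/
lemma integral_polarMonomial [IsFiniteMeasure μ] (hR : μ (Set.Icc 0 R ×ˢ Set.Icc 0 R)ᶜ = 0)
    (k l : ℕ × ℕ) :
    ∫ ω, polarMonomial l ω * conj (polarMonomial k ω) ∂polarMeasure μ =
      if k = l then ((∫ p, p.1 ^ k.1 * p.2 ^ k.2 ∂μ : ℝ) : ℂ) else 0 := by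
  have h : ∀ ω : PolarSpace, polarMonomial l ω * conj (polarMonomial k ω) =
      ((√ω.1.1 ^ l.1 * √ω.1.2 ^ l.2 * (√ω.1.1 ^ k.1 * √ω.1.2 ^ k.2) : ℝ) : ℂ) *
        ((fourier l.1 ω.2.1 * conj (fourier k.1 ω.2.1)) *
          (fourier l.2 ω.2.2 * conj (fourier k.2 ω.2.2))) := by
    intro ω
    simp only [polarMonomial, map_mul, Complex.conj_ofReal]
    push_cast
    ring
  simp_rw [h]
  rw [polarMeasure, integral_prod_mul
    (fun p : ℝ × ℝ => ((√p.1 ^ l.1 * √p.2 ^ l.2 * (√p.1 ^ k.1 * √p.2 ^ k.2) : ℝ) : ℂ))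
    (fun θ : UnitAddCircle × UnitAddCircle => (fourier l.1 θ.1 * conj (fourier k.1 θ.1)) *
          (fourier l.2 θ.2 * conj (fourier k.2 θ.2))),
    integral_prod_mul (fun θ : UnitAddCircle => fourier l.1 θ * conj (fourier k.1 θ))
      (fun θ : UnitAddCircle => fourier l.2 θ * conj (fourier k.2 θ)),
    integral_conj_fourier_mul, integral_conj_fourier_mul, integral_complex_ofReal]
  by_cases hkl : k = l
  · subst hkl
    simp only [if_true, mul_one]
    congr 1
    refine integral_congr_ae ?_
    have h : ∀ᵐ p ∂μ, p ∈ Set.Icc 0 R ×ˢ Set.Icc 0 R := hR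
    filter_upwards [h] with p hp
    rw [mul_mul_mul_comm, ← mul_pow, ← mul_pow, Real.mul_self_sqrt hp.1.1,
      Real.mul_self_sqrt hp.2.1]
  · rw [if_neg hkl]
    by_cases h1 : (k.1 : ℤ) = l.1
    · have h2 : (k.2 : ℤ) ≠ l.2 := fun h2 =>
        hkl (Prod.ext (by exact_mod_cast h1) (by exact_mod_cast h2))
      rw [if_neg h2]
      simp
    · rw [if_neg h1]
      simp

end

lemma moment₂_pos {A B : ℕ × ℕ → ℝ} (hA : ∀ k, 0 < A k) (hB : ∀ k, 0 < B k) (k : ℕ × ℕ) :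
    0 < moment₂ A B k := by
  unfold moment₂
  exact mul_pos (Finset.prod_pos fun _ _ => pow_pos (hA _) 2)
    (Finset.prod_pos fun _ _ => pow_pos (hB _) 2)

lemma moment₂_add_snd (A B : ℕ × ℕ → ℝ) (k : ℕ × ℕ) :
    moment₂ A B (k + (0, 1)) = B k ^ 2 * moment₂ A B k := by
  simp only [moment₂, Prod.fst_add, Prod.snd_add, add_zero, Finset.prod_range_succ]
  ring

/-- `moment₂` follows one fixed path, horizontal first. Commutation of the weights around each unit
square lets a horizontal step be moved up, by induction on the height. -/
lemma moment₂_add_fst {A B : ℕ × ℕ → ℝ}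
    (hAB : ∀ k, A k * B (k + (1, 0)) = B k * A (k + (0, 1))) (k : ℕ × ℕ) :
    moment₂ A B (k + (1, 0)) = A k ^ 2 * moment₂ A B k := by
  obtain ⟨k, l⟩ := k
  induction l with
  | zero => simp [moment₂, Finset.prod_range_succ]; ring
  | succ l ih =>
    have h1 := moment₂_add_snd A B ((k, l) + (1, 0))
    have h2 := moment₂_add_snd A B (k, l)
    have h3 := hAB (k, l)
    simp only [Prod.mk_add_mk, add_zero] at h1 h2 h3 ih ⊢
    rw [h1, ih, h2]
    linear_combination (A (k, l) * B (k + 1, l) + B (k, l) * A (k, l + 1)) *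
      moment₂ A B (k, l) * h3

lemma IsTwoVarShift.commute_weights {A B : ℕ × ℕ → ℝ} {T₁ T₂ : Ell2 →L[ℂ] Ell2}
    (h : IsTwoVarShift A B T₁ T₂) (hT : Commute T₁ T₂) (k : ℕ × ℕ) :
    A k * B (k + (1, 0)) = B k * A (k + (0, 1)) := by
  have h1 : T₂ (T₁ (e k)) = T₁ (T₂ (e k)) := (DFunLike.congr_fun hT.eq (e k)).symm
  rw [(h k).1, (h k).2, map_smul, map_smul, (h _).1, (h _).2, smul_smul, smul_smul,
    add_right_comm] at h1
  have h2 : e (k + (0, 1) + (1, 0)) ≠ 0 := by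
    rw [← norm_ne_zero_iff, e_norm]
    exact one_ne_zero
  exact_mod_cast smul_left_injective ℂ h2 h1

lemma continuousLinearMap_ext_e {F : Type*} [NormedAddCommGroup F] [NormedSpace ℂ F]
    {f g : Ell2 →L[ℂ] F} (h : ∀ k, f (e k) = g (e k)) : f = g := by
  refine lp.ext_continuousLinearMap (by simp) fun k => ?_
  ext
  exact h k

/-- A commuting 2-variable weighted shift whose moments are those of a compactly supported measure
on the positive quadrant is subnormal. -/
lemma isSubnormalPair_of_measure {A B : ℕ × ℕ → ℝ} {T₁ T₂ : Ell2 →L[ℂ] Ell2}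
    (hA : ∀ k, 0 < A k) (hB : ∀ k, 0 < B k) (h : IsTwoVarShift A B T₁ T₂) (hT : Commute T₁ T₂)
    {μ : Measure (ℝ × ℝ)} [IsFiniteMeasure μ] {R : ℝ}
    (hR : μ (Set.Icc 0 R ×ˢ Set.Icc 0 R)ᶜ = 0)
    (hmom : ∀ k : ℕ × ℕ, moment₂ A B k = ∫ p, p.1 ^ k.1 * p.2 ^ k.2 ∂μ) :
    IsSubnormalPair T₁ T₂ := by
  let γ := moment₂ A B
  have hγ : ∀ k, 0 < γ k := moment₂_pos hA hB
  let f : ℕ × ℕ → Lp ℂ 2 (polarMeasure μ) := fun k => (memLp_polarMonomial hR k 2).toLp _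
  let g : ℕ × ℕ → Lp ℂ ⊤ (polarMeasure μ) := fun k => (memLp_polarMonomial hR k ⊤).toLp _
  have hfg : ∀ k l, mulOp (g l) (f k) = f (k + l) := by
    intro k l
    refine Lp.ext ?_
    filter_upwards [coeFn_mulOp (g l) (f k), (memLp_polarMonomial hR k 2).coeFn_toLp,
      (memLp_polarMonomial hR l ⊤).coeFn_toLp, (memLp_polarMonomial hR (k + l) 2).coeFn_toLp]
      with ω h1 h2 h3 h4
    rw [h1, h2, h3, h4, polarMonomial_add, mul_comm]
  have hinner : ∀ k l, inner ℂ (f k) (f l) = if k = l then ((γ k : ℝ) : ℂ) else 0 := by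
    intro k l
    rw [L2.inner_def, show γ k = _ from hmom k, ← integral_polarMonomial hR k l]
    refine integral_congr_ae ?_
    filter_upwards [(memLp_polarMonomial hR k 2).coeFn_toLp,
      (memLp_polarMonomial hR l 2).coeFn_toLp] with ω h1 h2
    rw [h1, h2]
    rfl
  -- The monomial of index $k$ has norm $\sqrt{\gamma_k}$; normalizing gives the orthonormal family
  -- onto which the basis vectors `e k` are mapped.
  let F : ℕ × ℕ → Lp ℂ 2 (polarMeasure μ) := fun k => (((√(γ k))⁻¹ : ℝ) : ℂ) • f k
  have hF : Orthonormal ℂ F := by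
    rw [orthonormal_iff_ite]
    intro k l
    simp only [F, inner_smul_left, inner_smul_right, hinner, Complex.conj_ofReal]
    split_ifs with hkl
    · subst hkl
      rw [← Complex.ofReal_mul, ← Complex.ofReal_mul, ← mul_assoc, ← mul_inv,
        Real.mul_self_sqrt (hγ k).le, inv_mul_cancel₀ (hγ k).ne', Complex.ofReal_one]
    · simp
  have hshift : ∀ k l c, 0 < c → γ (k + l) = c ^ 2 * γ k →
      mulOp (g l) (F k) = (c : ℂ) • F (k + l) := by
    intro k l c hc hcγ
    simp only [F, map_smul, hfg, smul_smul, ← Complex.ofReal_mul]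
    congr 2
    rw [hcγ, Real.sqrt_mul (by positivity), Real.sqrt_sq hc.le]
    field_simp
  let V := hF.orthogonalFamily.linearIsometry
  have hV : ∀ k, V (e k) = F k := fun k => by
    simp [V, e]
  refine ⟨Lp ℂ 2 (polarMeasure μ), inferInstance, inferInstance, inferInstance, V,
    mulOp (g (1, 0)), mulOp (g (0, 1)), inferInstance, inferInstance, commute_mulOp _ _,
    fun x => ⟨?_, ?_⟩⟩
  · have : (mulOp (g (1, 0))).comp V.toContinuousLinearMap = V.toContinuousLinearMap.comp T₁ := by
      refine continuousLinearMap_ext_e fun k => ?_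
      simp only [ContinuousLinearMap.comp_apply, LinearIsometry.coe_toContinuousLinearMap, hV,
        (h k).1, map_smul]
      exact hshift k (1, 0) (A k) (hA k) (moment₂_add_fst (h.commute_weights hT) k)
    exact DFunLike.congr_fun this x
  · have : (mulOp (g (0, 1))).comp V.toContinuousLinearMap = V.toContinuousLinearMap.comp T₂ := by
      refine continuousLinearMap_ext_e fun k => ?_
      simp only [ContinuousLinearMap.comp_apply, LinearIsometry.coe_toContinuousLinearMap, hV,
        (h k).2, map_smul]
      exact hshift k (0, 1) (B k) (hB k) (moment₂_add_snd A B k)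
    exact DFunLike.congr_fun this x

/-! ### Determinacy of the moment problem for measures with bounded support -/

/-- The measure is carried by a bounded set. -/
def BddSupport {E : Type*} [MeasurableSpace E] [NormedAddCommGroup E] (μ : Measure E) : Prop :=
  ∃ R : ℝ, ∀ᵐ x ∂μ, ‖x‖ ≤ R

namespace BddSupport

section

variable {E : Type*} [MeasurableSpace E] [NormedAddCommGroup E] {μ ν : Measure E}

lemma mono (h : BddSupport μ) (hν : ν ≪ μ) : BddSupport ν :=
  h.imp fun _ hR => hν.ae_le hR

lemma smul (h : BddSupport μ) (c : ENNReal) : BddSupport (c • μ) :=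
  h.mono (Measure.smul_absolutelyContinuous)

lemma integrable [BorelSpace E] [ProperSpace E] [SecondCountableTopology E] [IsFiniteMeasure μ]
    (h : BddSupport μ) {F : Type*} [NormedAddCommGroup F] {f : E → F}
    (hf : Continuous f) : Integrable f μ := by
  obtain ⟨R, hR⟩ := h
  obtain ⟨C, hC⟩ := (isCompact_closedBall (0 : E) R).exists_bound_of_continuousOn hf.continuousOn
  refine Integrable.of_bound hf.aestronglyMeasurable C ?_
  filter_upwards [hR] with x hx
  exact hC x (by simpa using hx)

end

lemma of_Icc {ν : Measure ℝ} {a b : ℝ} (h : ∀ᵐ s ∂ν, s ∈ Set.Icc a b) : BddSupport ν := by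
  refine ⟨max |a| |b|, ?_⟩
  filter_upwards [h] with s hs
  exact abs_le_max_abs_abs hs.1 hs.2

lemma prod {μ ν : Measure ℝ} [SFinite ν] (hμ : BddSupport μ) (hν : BddSupport ν) :
    BddSupport (μ.prod ν) := by
  obtain ⟨R, hR⟩ := hμ
  obtain ⟨S, hS⟩ := hν
  refine ⟨max R S, ?_⟩
  filter_upwards [Measure.quasiMeasurePreserving_fst.ae hR,
    Measure.quasiMeasurePreserving_snd.ae hS] with p h1 h2
  exact max_le_max h1 h2

end BddSupport

/-- On a ball of radius $R$ the $n$-th term of the exponential series is at most $(\|L\|R)^n/n!$, so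
the series may be integrated term by term. Thus the characteristic function depends only on the
moments of linear functionals, which is the source of determinacy. -/
lemma charFunDual_eq_tsum {E : Type*} [NormedAddCommGroup E] [NormedSpace ℝ E] [MeasurableSpace E]
    [BorelSpace E] [ProperSpace E] [SecondCountableTopology E] {μ : Measure E} [IsFiniteMeasure μ]
    (h : BddSupport μ) (L : StrongDual ℝ E) :
    charFunDual μ L =
      ∑' n : ℕ, Complex.I ^ n / (n.factorial : ℂ) * ((∫ x, L x ^ n ∂μ : ℝ) : ℂ) := by
  obtain ⟨R, hR⟩ := id h
  let F : ℕ → E → ℂ := fun n x => (L x * Complex.I) ^ n / (n.factorial : ℂ)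
  have hF : ∀ n, Integrable (F n) μ := fun n => h.integrable (by fun_prop)
  have hbound : ∀ n, ∀ᵐ x ∂μ, ‖F n x‖ ≤ (‖L‖ * R) ^ n / n.factorial := by
    intro n
    filter_upwards [hR] with x hx
    simp only [F, norm_div, norm_pow, norm_mul, Complex.norm_I, mul_one, Complex.norm_real,
      Complex.norm_natCast]
    have : ‖L x‖ ≤ ‖L‖ * R := (L.le_opNorm x).trans (by gcongr)
    gcongr
  have hsum : Summable fun n => ∫ x, ‖F n x‖ ∂μ := by
    refine Summable.of_nonneg_of_le (fun n => integral_nonneg fun x => norm_nonneg _) (fun n => ?_)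
      ((Real.summable_pow_div_factorial (‖L‖ * R)).mul_left (μ.real Set.univ))
    have := integral_mono_ae (hF n).norm (integrable_const _) (hbound n)
    simpa using this
  have key := (hasSum_integral_of_summable_integral_norm hF hsum).tsum_eq
  have hexp : ∀ x, ∑' n, F n x = Complex.exp (L x * Complex.I) := by
    intro x
    rw [Complex.exp_eq_exp_ℂ, NormedSpace.exp_eq_tsum_div]
  rw [charFunDual_apply]
  simp_rw [← hexp]
  rw [← key]
  refine tsum_congr fun n => ?_
  rw [← integral_complex_ofReal, ← integral_const_mul]
  refine integral_congr_ae (Filter.Eventually.of_forall fun x => ?_)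
  simp only [F, mul_pow]
  push_cast
  ring

lemma ext_of_integral_pow {μ ν : Measure ℝ} [IsFiniteMeasure μ] [IsFiniteMeasure ν]
    (hμ : BddSupport μ) (hν : BddSupport ν) (h : ∀ n : ℕ, ∫ s, s ^ n ∂μ = ∫ s, s ^ n ∂ν) :
    μ = ν := by
  refine Measure.ext_of_charFunDual (funext fun L => ?_)
  rw [charFunDual_eq_tsum hμ, charFunDual_eq_tsum hν]
  refine tsum_congr fun n => ?_
  have hL : ∀ s, L s ^ n = L 1 ^ n * s ^ n := fun s => by
    rw [← mul_pow, mul_comm, ← smul_eq_mul, ← map_smul, smul_eq_mul, mul_one]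
  rw [integral_congr_ae (Filter.Eventually.of_forall hL),
    integral_congr_ae (μ := ν) (Filter.Eventually.of_forall hL), integral_const_mul,
    integral_const_mul, h]

/-- A linear functional on the plane is a combination of the two coordinates, so the binomial
theorem expresses its powers through mixed monomials, and the characteristic functions agree. -/
lemma ext_of_integral_pow_mul_pow {μ ν : Measure (ℝ × ℝ)} [IsFiniteMeasure μ] [IsFiniteMeasure ν]
    (hμ : BddSupport μ) (hν : BddSupport ν)
    (h : ∀ k l : ℕ, ∫ p, p.1 ^ k * p.2 ^ l ∂μ = ∫ p, p.1 ^ k * p.2 ^ l ∂ν) : μ = ν := by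
  refine Measure.ext_of_charFunDual (funext fun L => ?_)
  rw [charFunDual_eq_tsum hμ, charFunDual_eq_tsum hν]
  refine tsum_congr fun n => ?_
  have hL : ∀ p : ℝ × ℝ, L p ^ n = ∑ m ∈ Finset.range (n + 1),
      (L (1, 0) ^ m * L (0, 1) ^ (n - m) * n.choose m) * (p.1 ^ m * p.2 ^ (n - m)) := by
    intro p
    have : L p = L (1, 0) * p.1 + L (0, 1) * p.2 := by
      have hp : p = p.1 • (1, 0) + p.2 • ((0, 1) : ℝ × ℝ) := by ext <;> simp
      conv_lhs => rw [hp]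
      simp only [map_add, map_smul, smul_eq_mul]
      ring
    rw [this, add_pow]
    refine Finset.sum_congr rfl fun m _ => ?_
    ring
  have key : ∀ ρ : Measure (ℝ × ℝ), IsFiniteMeasure ρ → BddSupport ρ → ∫ p, L p ^ n ∂ρ =
      ∑ m ∈ Finset.range (n + 1), (L (1, 0) ^ m * L (0, 1) ^ (n - m) * n.choose m) *
        ∫ p, p.1 ^ m * p.2 ^ (n - m) ∂ρ := by
    intro ρ _ hρ
    rw [integral_congr_ae (Filter.Eventually.of_forall hL)]
    rw [integral_finsetSum _ fun m _ => hρ.integrable (by fun_prop)]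
    simp_rw [integral_const_mul]
  rw [key μ inferInstance hμ, key ν inferInstance hν]
  simp_rw [h]

/-! ### Multiplying and dividing a measure by the coordinate -/

/-- The measure `s dν(s)` on the positive half-line. -/
def mulId (ν : Measure ℝ) : Measure ℝ := ν.withDensity fun s => ENNReal.ofReal s

/-- The measure `dν(s) / s` on the positive half-line. -/
def divId (ν : Measure ℝ) : Measure ℝ := ν.withDensity fun s => ENNReal.ofReal (1 / s)

/-- `ENNReal.ofReal` truncates negative values to zero and `1 / 0 = 0`, so the two densities are
mutually inverse exactly on the open half-line. This is why multiplying and dividing by the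
coordinate loses whatever sits at the origin. -/
lemma mul_ofReal_one_div_eq_indicator :
    ((fun s => ENNReal.ofReal s) * fun s : ℝ => ENNReal.ofReal (1 / s)) =
      (Set.Ioi (0 : ℝ)).indicator 1 := by
  ext s
  by_cases hs : 0 < s
  · rw [Set.indicator_of_mem (by exact hs), Pi.mul_apply, ← ENNReal.ofReal_mul hs.le,
      mul_one_div_cancel hs.ne']
    simp
  · rw [Set.indicator_of_notMem (by exact hs), Pi.mul_apply,
      ENNReal.ofReal_of_nonpos (not_lt.1 hs), zero_mul]

section

variable (ν ρ : Measure ℝ)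

lemma divId_mulId : divId (mulId ν) = ν.restrict (Set.Ioi 0) := by
  rw [divId, mulId, ← withDensity_mul _ (by fun_prop) (by fun_prop),
    mul_ofReal_one_div_eq_indicator, withDensity_indicator_one measurableSet_Ioi]

lemma mulId_divId : mulId (divId ν) = ν.restrict (Set.Ioi 0) := by
  rw [divId, mulId, ← withDensity_mul _ (by fun_prop) (by fun_prop), mul_comm,
    mul_ofReal_one_div_eq_indicator, withDensity_indicator_one measurableSet_Ioi]

lemma mulId_divId_of_pos {ν : Measure ℝ} (h : ∀ᵐ s ∂ν, 0 < s) : mulId (divId ν) = ν := by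
  rw [mulId_divId, Measure.restrict_eq_self_of_ae_mem (s := Set.Ioi 0) h]

lemma mulId_restrict : mulId (ν.restrict (Set.Ioi 0)) = mulId ν := by
  rw [mulId, mulId, ← withDensity_indicator measurableSet_Ioi]
  congr 1
  ext s
  by_cases hs : 0 < s
  · exact Set.indicator_of_mem (by exact hs) _
  · rw [Set.indicator_of_notMem (by exact hs), ENNReal.ofReal_of_nonpos (not_lt.1 hs)]

lemma mulId_add : mulId (ν + ρ) = mulId ν + mulId ρ := withDensity_add_measure _ _ _

lemma mulId_smul (c : ENNReal) : mulId (c • ν) = c • mulId ν := withDensity_smul_measure _ _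

lemma divId_smul (c : ENNReal) : divId (c • ν) = c • divId ν := withDensity_smul_measure _ _

lemma mulId_dirac_zero : mulId (Measure.dirac 0) = 0 := by
  rw [← mulId_restrict, restrict_dirac' measurableSet_Ioi]
  simp [mulId]

lemma mulId_absolutelyContinuous : mulId ν ≪ ν := withDensity_absolutelyContinuous _ _

lemma divId_absolutelyContinuous : divId ν ≪ ν := withDensity_absolutelyContinuous _ _

lemma integral_pow_mulId {ν : Measure ℝ} (h : ∀ᵐ s ∂ν, 0 ≤ s) (n : ℕ) :
    ∫ s, s ^ n ∂mulId ν = ∫ s, s ^ (n + 1) ∂ν := by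
  rw [mulId, integral_withDensity_eq_integral_toReal_smul₀ (by fun_prop) (by simp)]
  refine integral_congr_ae ?_
  filter_upwards [h] with s hs
  rw [ENNReal.toReal_ofReal hs, smul_eq_mul, pow_succ']

lemma isFiniteMeasure_mulId {ν : Measure ℝ} [IsFiniteMeasure ν] (h : BddSupport ν) :
    IsFiniteMeasure (mulId ν) :=
  isFiniteMeasure_withDensity_ofReal (h.integrable continuous_id).2

lemma pos_mulId : ∀ᵐ s ∂mulId ν, 0 < s := by
  rw [mulId, ae_withDensity_iff (by fun_prop)]
  refine Filter.Eventually.of_forall fun s hs => ?_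
  by_contra h
  exact hs (ENNReal.ofReal_of_nonpos (not_lt.1 h))

end

/-- The measure `s t dμ(s, t)` on the positive quadrant. -/
def mulId₂ (μ : Measure (ℝ × ℝ)) : Measure (ℝ × ℝ) :=
  μ.withDensity fun p => ENNReal.ofReal p.1 * ENNReal.ofReal p.2

lemma mulId₂_add (μ ν : Measure (ℝ × ℝ)) : mulId₂ (μ + ν) = mulId₂ μ + mulId₂ ν :=
  withDensity_add_measure _ _ _

lemma mulId₂_smul (c : ENNReal) (μ : Measure (ℝ × ℝ)) : mulId₂ (c • μ) = c • mulId₂ μ :=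
  withDensity_smul_measure _ _

lemma mulId₂_prod (μ ν : Measure ℝ) [SFinite μ] [SFinite ν] :
    mulId₂ (μ.prod ν) = (mulId μ).prod (mulId ν) :=
  (prod_withDensity (by fun_prop) (by fun_prop)).symm

lemma integral_pow_mulId₂ {μ : Measure (ℝ × ℝ)} (h : ∀ᵐ p ∂μ, 0 ≤ p.1 ∧ 0 ≤ p.2) (k l : ℕ) :
    ∫ p, p.1 ^ k * p.2 ^ l ∂mulId₂ μ = ∫ p, p.1 ^ (k + 1) * p.2 ^ (l + 1) ∂μ := by
  rw [mulId₂, integral_withDensity_eq_integral_toReal_smul₀ (by fun_prop)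
    (by simp [ENNReal.mul_lt_top])]
  refine integral_congr_ae ?_
  filter_upwards [h] with p hp
  rw [ENNReal.toReal_mul, ENNReal.toReal_ofReal hp.1, ENNReal.toReal_ofReal hp.2, smul_eq_mul]
  ring

lemma isFiniteMeasure_mulId₂ {μ : Measure (ℝ × ℝ)} [IsFiniteMeasure μ] (h : BddSupport μ)
    (hμ : ∀ᵐ p ∂μ, 0 ≤ p.1 ∧ 0 ≤ p.2) : IsFiniteMeasure (mulId₂ μ) := by
  have : mulId₂ μ = μ.withDensity fun p => ENNReal.ofReal (p.1 * p.2) := by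
    refine withDensity_congr_ae ?_
    filter_upwards [hμ] with p hp
    rw [ENNReal.ofReal_mul hp.1]
  rw [this]
  exact isFiniteMeasure_withDensity_ofReal (h.integrable (by fun_prop)).2

/-- The open positive quadrant. -/
abbrev openQuadrant : Set (ℝ × ℝ) := Set.Ioi 0 ×ˢ Set.Ioi 0

/-- Dividing $st\,d\mu$ by $st$ recovers $\mu$ where $st$ can be inverted, and says nothing about
the axes. -/
lemma restrict_openQuadrant_of_mulId₂_eq {μ : Measure (ℝ × ℝ)} {c : ENNReal} {ξ η : Measure ℝ}
    [SFinite ξ] [SFinite η] (h : mulId₂ μ = c • ξ.prod η) :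
    μ.restrict openQuadrant = c • (divId ξ).prod (divId η) := by
  have h1 : (mulId₂ μ).withDensity (fun p => ENNReal.ofReal (1 / p.1) * ENNReal.ofReal (1 / p.2)) =
      μ.restrict openQuadrant := by
    rw [mulId₂, ← withDensity_mul _ (by fun_prop) (by fun_prop),
      ← withDensity_indicator_one (measurableSet_Ioi.prod measurableSet_Ioi)]
    congr 1
    ext p
    have e1 := congrFun mul_ofReal_one_div_eq_indicator p.1
    have e2 := congrFun mul_ofReal_one_div_eq_indicator p.2
    simp only [Pi.mul_apply] at e1 e2 ⊢
    rw [mul_mul_mul_comm, e1, e2]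
    simp only [Set.indicator_apply, Set.mem_prod, Pi.one_apply]
    split_ifs <;> simp_all
  rw [← h1, h, withDensity_smul_measure, divId, divId, prod_withDensity (by fun_prop) (by fun_prop)]

/-! ### Marginals of a measure whose core is a product -/

lemma eq_smul_dirac_zero {ν : Measure ℝ} (h : ∀ᵐ s ∂ν, s = 0) :
    ν = ν Set.univ • Measure.dirac 0 := by
  ext s hs
  rw [Measure.smul_apply, Measure.dirac_apply' _ hs, smul_eq_mul]
  by_cases h0 : (0 : ℝ) ∈ s
  · rw [Set.indicator_of_mem h0, Pi.one_apply, mul_one]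
    refine measure_congr ?_
    filter_upwards [h] with x hx
    rw [hx]
    exact propext ⟨fun _ => trivial, fun _ => h0⟩
  · rw [Set.indicator_of_notMem h0, mul_zero]
    refine measure_mono_null (fun x hx => ?_) h
    rintro (rfl : x = 0)
    exact h0 hx

/-- The marginals of `μ` are `ξx` and `ηy`, and `s t dμ(s, t) = c d(ξ × η)`. -/
structure HasProductCore (μ : Measure (ℝ × ℝ)) (c : ENNReal) (ξx ηy ξ η : Measure ℝ) : Prop where
  fst_eq : μ.map Prod.fst = ξx
  snd_eq : μ.map Prod.snd = ηy
  mulId₂_eq : mulId₂ μ = c • ξ.prod η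

/-- The decomposition of the marginals of a measure with core proportional to `ξ × η` in terms of
the parts `Ψ` and `Φ` that come from the coordinate axes. -/
structure IsAxisDecomposition (A Y : ENNReal) (ξx ηy₁ ξ η Ψ Φ : Measure ℝ) : Prop where
  vertical : ηy₁ = Ψ + (A * divId ξ Set.univ) • η
  horizontal : ξx = Φ + (Y * divId Ψ Set.univ) • Measure.dirac 0 +
    (A * Y * divId η Set.univ) • divId ξ

/-- The measure with core proportional to `ξ × η` and prescribed axis parts. -/
def glue (A Y : ENNReal) (ξ η Ψ Φ : Measure ℝ) : Measure (ℝ × ℝ) :=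
  Φ.prod (Measure.dirac 0) + (Measure.dirac 0).prod (Y • divId Ψ) +
    (A * Y) • (divId ξ).prod (divId η)

section

variable {ξx ηy ηy₁ ξ η : Measure ℝ}

lemma HasProductCore.nonneg {μ : Measure (ℝ × ℝ)} {c : ENNReal}
    (h : HasProductCore μ c ξx ηy ξ η) (hx : ∀ᵐ s ∂ξx, 0 ≤ s) (hy : ∀ᵐ t ∂ηy, 0 ≤ t) :
    ∀ᵐ p ∂μ, 0 ≤ p.1 ∧ 0 ≤ p.2 := by
  rw [← h.fst_eq] at hx
  rw [← h.snd_eq] at hy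
  exact (ae_of_ae_map (by fun_prop) hx).and (ae_of_ae_map (by fun_prop) hy)

/-- The moments of a measure with product core are determined by the core and the marginals. -/
lemma HasProductCore.integral_eq {μ : Measure (ℝ × ℝ)} {c : ENNReal}
    [SFinite ξ] [SFinite η]
    (h : HasProductCore μ c ξx ηy ξ η) (hx : ∀ᵐ s ∂ξx, 0 ≤ s) (hy : ∀ᵐ t ∂ηy, 0 ≤ t) :
    (∀ k : ℕ, ∫ p, p.1 ^ k ∂μ = ∫ s, s ^ k ∂ξx) ∧
    (∀ l : ℕ, ∫ p, p.2 ^ l ∂μ = ∫ t, t ^ l ∂ηy) ∧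
    ∀ k l : ℕ, ∫ p, p.1 ^ (k + 1) * p.2 ^ (l + 1) ∂μ =
      c.toReal * ((∫ s, s ^ k ∂ξ) * ∫ t, t ^ l ∂η) := by
  refine ⟨fun k => ?_, fun l => ?_, fun k l => ?_⟩
  · rw [← h.fst_eq, integral_map (by fun_prop) (by fun_prop)]
  · rw [← h.snd_eq, integral_map (by fun_prop) (by fun_prop)]
  · rw [← integral_pow_mulId₂ (h.nonneg hx hy), h.mulId₂_eq, integral_smul_measure,
      integral_prod_mul (fun s : ℝ => s ^ k) (fun t : ℝ => t ^ l), smul_eq_mul]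

/-- The marginals are identified first, from the pure moments, and they place $\mu$ in the closed
quadrant. Only then is $st\,d\mu$ known to have the mixed moments of $\mu$ shifted by one, and
determinacy applies to it as well. -/
lemma HasProductCore.of_integral_eq {μ : Measure (ℝ × ℝ)} [IsFiniteMeasure μ] {c : ENNReal}
    [IsFiniteMeasure ξx] [IsFiniteMeasure ηy] [IsFiniteMeasure ξ] [IsFiniteMeasure η]
    (hc : c ≠ ⊤) (hμ : BddSupport μ)
    (bx : BddSupport ξx) (by' : BddSupport ηy) (bξ : BddSupport ξ) (bη : BddSupport η)
    (hx : ∀ᵐ s ∂ξx, 0 ≤ s) (hy : ∀ᵐ t ∂ηy, 0 ≤ t)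
    (h₁ : ∀ k : ℕ, ∫ p, p.1 ^ k ∂μ = ∫ s, s ^ k ∂ξx)
    (h₂ : ∀ l : ℕ, ∫ p, p.2 ^ l ∂μ = ∫ t, t ^ l ∂ηy)
    (h₃ : ∀ k l : ℕ, ∫ p, p.1 ^ (k + 1) * p.2 ^ (l + 1) ∂μ =
      c.toReal * ((∫ s, s ^ k ∂ξ) * ∫ t, t ^ l ∂η)) :
    HasProductCore μ c ξx ηy ξ η := by
  obtain ⟨R, hR⟩ := id hμ
  have f₁ : μ.map Prod.fst = ξx := by
    refine ext_of_integral_pow ⟨R, ?_⟩ bx fun k => ?_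
    · rw [ae_map_iff (by fun_prop) (measurableSet_le (by fun_prop) (by fun_prop))]
      filter_upwards [hR] with p hp using (norm_fst_le p).trans hp
    · rw [← h₁, integral_map (by fun_prop) (by fun_prop)]
  have f₂ : μ.map Prod.snd = ηy := by
    refine ext_of_integral_pow ⟨R, ?_⟩ by' fun k => ?_
    · rw [ae_map_iff (by fun_prop) (measurableSet_le (by fun_prop) (by fun_prop))]
      filter_upwards [hR] with p hp using (norm_snd_le p).trans hp
    · rw [← h₂, integral_map (by fun_prop) (by fun_prop)]
  have hnn : ∀ᵐ p ∂μ, 0 ≤ p.1 ∧ 0 ≤ p.2 := by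
    rw [← f₁] at hx
    rw [← f₂] at hy
    exact (ae_of_ae_map (by fun_prop) hx).and (ae_of_ae_map (by fun_prop) hy)
  refine ⟨f₁, f₂, ?_⟩
  have := isFiniteMeasure_mulId₂ hμ hnn
  have : IsFiniteMeasure (c • ξ.prod η) := Measure.smul_finite _ hc
  refine ext_of_integral_pow_mul_pow (hμ.mono (withDensity_absolutelyContinuous _ _))
    ((bξ.prod bη).smul c) fun k l => ?_
  rw [integral_pow_mulId₂ hnn, h₃, integral_smul_measure,
    integral_prod_mul (fun s : ℝ => s ^ k) (fun t : ℝ => t ^ l), smul_eq_mul]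

/-- The core equation fixes $\mu$ on the open quadrant. Projecting the pieces of $\mu$ on the axes
and on the open quadrant to each coordinate gives the two decompositions; on the vertical side the
projection is multiplied by $t$, which removes the origin and turns $\eta_y$ into $Y(\eta_y)_1$. -/
lemma HasProductCore.exists_axisDecomposition {μ : Measure (ℝ × ℝ)} [IsFiniteMeasure μ]
    {A Y : ENNReal} [IsFiniteMeasure ξ] [IsFiniteMeasure η] [IsFiniteMeasure (divId ξ)]
    [IsFiniteMeasure (divId η)]
    (hY : Y ≠ 0) (hY' : Y ≠ ⊤)
    (h : HasProductCore μ (A * Y) ξx ηy ξ η) (hx : ∀ᵐ s ∂ξx, 0 ≤ s)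
    (hη : ∀ᵐ t ∂η, 0 < t) (hηy₁ : mulId ηy = Y • ηy₁) :
    ∃ Ψ Φ : Measure ℝ, IsAxisDecomposition A Y ξx ηy₁ ξ η Ψ Φ := by
  have hx' : ∀ᵐ p ∂μ, 0 ≤ p.1 := by
    rw [← h.fst_eq] at hx
    exact ae_of_ae_map (by fun_prop) hx
  have hcore := restrict_openQuadrant_of_mulId₂_eq h.mulId₂_eq
  -- Up to null sets this is the part of `μ` on the open vertical half-axis. The origin is assigned
  -- to `Φ`, and `Ψ` carries the factor `Y⁻¹` so that its sum with a multiple of `η` is `ηy₁`.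
  let μ₀ := μ.restrict (Set.Iic 0 ×ˢ Set.Ioi 0)
  let Ψ := Y⁻¹ • mulId (μ₀.map Prod.snd)
  let Φ := (μ.restrict (Prod.snd ⁻¹' Set.Iic 0)).map Prod.fst
  have hsplit : μ.restrict (Prod.snd ⁻¹' Set.Ioi 0) =
      μ₀ + (A * Y) • (divId ξ).prod (divId η) := by
    rw [← hcore, ← Measure.restrict_union _ (measurableSet_Ioi.prod measurableSet_Ioi)]
    · congr 1
      ext p
      simp only [Set.mem_preimage, Set.mem_union, Set.mem_prod, Set.mem_Iic, Set.mem_Ioi]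
      have := le_or_gt p.1 0
      tauto
    · rw [Set.disjoint_left]
      exact fun p h1 h2 => not_lt.2 (Set.mem_Iic.1 h1.1) h2.1
  have hYΨ : Y • Ψ = mulId (μ₀.map Prod.snd) := by
    rw [smul_smul, ENNReal.mul_inv_cancel hY hY', one_smul]
  have hmass : Y * divId Ψ Set.univ = μ₀ Set.univ := by
    rw [← smul_eq_mul, ← Measure.smul_apply, ← divId_smul, hYΨ, divId_mulId,
      Measure.restrict_apply_univ, Measure.map_apply (by fun_prop) measurableSet_Ioi]
    rw [Measure.restrict_apply (measurable_snd measurableSet_Ioi), Measure.restrict_apply_univ]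
    congr 1
    ext p
    simp only [Set.mem_inter_iff, Set.mem_preimage, Set.mem_prod]
    tauto
  refine ⟨Ψ, Φ, ?_, ?_⟩
  · have h1 : ηy.restrict (Set.Ioi 0) =
        μ₀.map Prod.snd + (A * Y * divId ξ Set.univ) • divId η := by
      rw [← h.snd_eq, Measure.restrict_map measurable_snd measurableSet_Ioi, hsplit,
        Measure.map_add _ _ measurable_snd, Measure.map_smul, Measure.map_snd_prod, smul_smul]
    have h2 : Y • ηy₁ = Y • (Ψ + (A * divId ξ Set.univ) • η) := by
      rw [← hηy₁, ← mulId_restrict, h1, mulId_add, mulId_smul, mulId_divId_of_pos hη, smul_add,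
        hYΨ, smul_smul]
      congr 2
      ring
    have h3 := congrArg (fun ν => Y⁻¹ • ν) h2
    simpa only [smul_smul, ENNReal.inv_mul_cancel hY hY', one_smul] using h3
  · have h0 : μ₀.map Prod.fst = (Y * divId Ψ Set.univ) • Measure.dirac 0 := by
      have : ∀ᵐ s ∂μ₀.map Prod.fst, s = 0 := by
        rw [ae_map_iff (by fun_prop) (measurableSet_eq_fun (by fun_prop) (by fun_prop))]
        filter_upwards [ae_restrict_of_ae hx',
          ae_restrict_mem (measurableSet_Iic.prod measurableSet_Ioi)] with p h1 h2
        exact le_antisymm h2.1 h1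
      rw [eq_smul_dirac_zero this, hmass, Measure.map_apply measurable_fst MeasurableSet.univ,
        Set.preimage_univ]
    have hcompl : (Prod.snd ⁻¹' Set.Iic 0 : Set (ℝ × ℝ))ᶜ = Prod.snd ⁻¹' Set.Ioi 0 := by
      rw [← Set.preimage_compl, Set.compl_Iic]
    rw [← h.fst_eq, ← Measure.restrict_add_restrict_compl (μ := μ)
      (measurable_snd (measurableSet_Iic (a := (0 : ℝ)))), hcompl, hsplit,
      Measure.map_add _ _ measurable_fst, Measure.map_add _ _ measurable_fst, h0,
      Measure.map_smul, Measure.map_fst_prod, smul_smul, add_assoc]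

/-- The measure $Y\,d\eta_{y,1}(t)/t$ is $\eta_y$ restricted to $(0,\infty)$, hence finite, and
domination by $\eta_{y,1}$ passes this on to $\Psi$. So $\|1/t\|_{L^1(\psi)}$ is finite without
being assumed. -/
lemma isFiniteMeasure_divId_of_le {Y : ENNReal} {Ψ : Measure ℝ} [IsFiniteMeasure ηy] (hY : Y ≠ 0)
    (hηy₁ : mulId ηy = Y • ηy₁) (hΨ : Ψ ≤ ηy₁) : IsFiniteMeasure (divId Ψ) := by
  have h1 : Y • divId ηy₁ = ηy.restrict (Set.Ioi 0) := by
    rw [← divId_smul, ← hηy₁, divId_mulId]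
  have h2 : divId ηy₁ Set.univ < ⊤ := by
    have h3 : Y * divId ηy₁ Set.univ < ⊤ := by
      rw [← smul_eq_mul, ← Measure.smul_apply, h1]
      exact measure_lt_top _ _
    rw [lt_top_iff_ne_top] at h3 ⊢
    rintro h4
    exact h3 (by rw [h4, ENNReal.mul_top hY])
  refine ⟨lt_of_le_of_lt ?_ h2⟩
  rw [divId, divId, withDensity_apply _ MeasurableSet.univ, withDensity_apply _ MeasurableSet.univ,
    Measure.restrict_univ, Measure.restrict_univ]
  exact lintegral_mono' hΨ le_rfl

lemma pos_of_le {Y : ENNReal} {Ψ : Measure ℝ} (hY : Y ≠ 0) (hηy₁ : mulId ηy = Y • ηy₁)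
    (hΨ : Ψ ≤ ηy₁) : ∀ᵐ t ∂Ψ, 0 < t := by
  have h1 : ∀ᵐ t ∂(Y • ηy₁), 0 < t := hηy₁ ▸ pos_mulId ηy
  exact hΨ.absolutelyContinuous.ae_le ((Measure.absolutelyContinuous_smul hY).ae_le h1)

lemma IsAxisDecomposition.vertical_le {A Y : ENNReal} {Ψ Φ : Measure ℝ}
    (hD : IsAxisDecomposition A Y ξx ηy₁ ξ η Ψ Φ) : Ψ ≤ ηy₁ := by
  rw [hD.vertical]
  exact Measure.le_add_right le_rfl

lemma IsAxisDecomposition.horizontal_le {A Y : ENNReal} {Ψ Φ : Measure ℝ}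
    (hD : IsAxisDecomposition A Y ξx ηy₁ ξ η Ψ Φ) : Φ ≤ ξx := by
  rw [hD.horizontal, add_assoc]
  exact Measure.le_add_right le_rfl

/-- The first marginal is the horizontal decomposition itself, so the total mass is 1. The second
marginal agrees with $\eta_y$ after multiplication by $t$, by the vertical decomposition; its atom
at 0 is then forced by the total mass. -/
lemma IsAxisDecomposition.hasProductCore_glue {A Y : ENNReal} {Ψ Φ : Measure ℝ}
    [IsProbabilityMeasure ξx] [IsProbabilityMeasure ηy] [IsFiniteMeasure Φ]
    [IsFiniteMeasure (divId ξ)] [IsFiniteMeasure (divId η)] (hY : Y ≠ 0)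
    (hD : IsAxisDecomposition A Y ξx ηy₁ ξ η Ψ Φ) (hξ : ∀ᵐ s ∂ξ, 0 < s) (hη : ∀ᵐ t ∂η, 0 < t)
    (hηy₁ : mulId ηy = Y • ηy₁) {R : ℝ} (hR : 0 ≤ R) (sy : ∀ᵐ t ∂ηy, t ∈ Set.Icc 0 R)
    (sy₁ : ∀ᵐ t ∂ηy₁, t ∈ Set.Icc 0 R) (sη : ∀ᵐ t ∂η, t ∈ Set.Icc 0 R) :
    HasProductCore (glue A Y ξ η Ψ Φ) (A * Y) ξx ηy ξ η := by
  have hfin := isFiniteMeasure_divId_of_le hY hηy₁ hD.vertical_le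
  have hfst : (glue A Y ξ η Ψ Φ).map Prod.fst = ξx := by
    rw [glue, Measure.map_add _ _ measurable_fst, Measure.map_add _ _ measurable_fst,
      Measure.map_smul, Measure.map_fst_prod, Measure.map_fst_prod, Measure.map_fst_prod,
      smul_smul, hD.horizontal, measure_univ, one_smul, Measure.smul_apply, smul_eq_mul]
  have huniv : glue A Y ξ η Ψ Φ Set.univ = 1 := by
    rw [← Set.preimage_univ (f := Prod.fst), ← Measure.map_apply measurable_fst MeasurableSet.univ,
      hfst, measure_univ]
  have hprob : IsProbabilityMeasure (glue A Y ξ η Ψ Φ) := ⟨huniv⟩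
  have hΨle : Ψ ≪ ηy₁ := hD.vertical_le.absolutelyContinuous
  have hΨ := pos_of_le hY hηy₁ hD.vertical_le
  refine ⟨hfst, ?_, ?_⟩
  · have hsnd : (glue A Y ξ η Ψ Φ).map Prod.snd = Φ Set.univ • Measure.dirac 0 + Y • divId Ψ +
        (A * Y * divId ξ Set.univ) • divId η := by
      rw [glue, Measure.map_add _ _ measurable_snd, Measure.map_add _ _ measurable_snd,
        Measure.map_smul, Measure.map_snd_prod, Measure.map_snd_prod, Measure.map_snd_prod,
        show Measure.dirac (0 : ℝ) Set.univ = 1 from measure_univ, one_smul, smul_smul]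
    have hmul : mulId ((glue A Y ξ η Ψ Φ).map Prod.snd) = mulId ηy := by
      rw [hsnd, mulId_add, mulId_add, mulId_smul, mulId_smul, mulId_smul, mulId_dirac_zero,
        mulId_divId_of_pos hΨ, mulId_divId_of_pos hη, hηy₁, hD.vertical, smul_zero, zero_add,
        smul_add, smul_smul]
      congr 2
      ring
    have hsupp : ∀ᵐ t ∂(glue A Y ξ η Ψ Φ).map Prod.snd, t ∈ Set.Icc 0 R := by
      rw [hsnd, ae_add_measure_iff, ae_add_measure_iff]
      refine ⟨⟨?_, ?_⟩, ?_⟩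
      · refine Measure.smul_absolutelyContinuous.ae_le ?_
        exact (ae_dirac_iff measurableSet_Icc).2 ⟨le_rfl, hR⟩
      · exact ((Measure.smul_absolutelyContinuous.trans (divId_absolutelyContinuous Ψ)).trans
          hΨle).ae_le sy₁
      · exact (Measure.smul_absolutelyContinuous.trans (divId_absolutelyContinuous η)).ae_le sη
    have : IsProbabilityMeasure ((glue A Y ξ η Ψ Φ).map Prod.snd) :=
      Measure.isProbabilityMeasure_map (by fun_prop)
    -- The zeroth moments agree because both are probability measures; every higher moment is a
    -- moment of `mulId`.
    refine ext_of_integral_pow (.of_Icc hsupp) (.of_Icc sy) fun n => ?_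
    cases n with
    | zero => simp
    | succ n =>
      rw [← integral_pow_mulId (hsupp.mono fun _ h => h.1),
        ← integral_pow_mulId (sy.mono fun _ h => h.1), hmul]
  · rw [glue, mulId₂_add, mulId₂_add, mulId₂_smul, mulId₂_prod, mulId₂_prod, mulId₂_prod,
      mulId_dirac_zero, mulId_divId_of_pos hξ, mulId_divId_of_pos hη, Measure.prod_zero,
      Measure.zero_prod, zero_add, zero_add]

end

/-! ### The signed measures attached to the diagram -/

instance {X : Type*} [MeasurableSpace X] (ν : Measure X) [IsFiniteMeasure ν] :
    IsFiniteMeasure ν.toSignedMeasure.variation := by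
  rw [Measure.variation_toSignedMeasure]
  infer_instance

lemma ext_of_real {X : Type*} [MeasurableSpace X] {μ ν : Measure X} [IsFiniteMeasure μ]
    [IsFiniteMeasure ν] (h : ∀ s, MeasurableSet s → μ.real s = ν.real s) : μ = ν := by
  ext s hs
  exact (measureReal_eq_measureReal_iff (by finiteness) (by finiteness)).1 (h s hs)

lemma exists_toSignedMeasure_eq {X : Type*} [MeasurableSpace X] {ν : SignedMeasure X}
    (h : 0 ≤ ν) : ∃ ρ : Measure X, ∃ _ : IsFiniteMeasure ρ, ρ.toSignedMeasure = ν :=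
  ⟨_, inferInstance, SignedMeasure.toMeasureOfZeroLE_toSignedMeasure ν
    ((VectorMeasure.le_restrict_univ_iff_le _ _).2 h)⟩

section

variable {ν : Measure ℝ}

lemma invNorm_toSignedMeasure [IsFiniteMeasure ν] (h : ∀ᵐ s ∂ν, 0 < s) :
    invNorm ν.toSignedMeasure = (divId ν).real Set.univ := by
  rw [invNorm, Measure.variation_toSignedMeasure, Measure.real, divId,
    withDensity_apply _ MeasurableSet.univ, Measure.restrict_univ,
    integral_eq_lintegral_of_nonneg_ae (Filter.Eventually.of_forall fun s => abs_nonneg _)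
      (by fun_prop)]
  congr 1
  refine lintegral_congr_ae ?_
  filter_upwards [h] with s hs
  rw [abs_of_pos (one_div_pos.2 hs)]

lemma integrable_one_div (h : ∀ᵐ s ∂ν, 0 < s) [IsFiniteMeasure (divId ν)] :
    Integrable (fun s => 1 / s) ν := by
  refine (lintegral_ofReal_ne_top_iff_integrable (by fun_prop) ?_).1 ?_
  · filter_upwards [h] with s hs using (one_div_pos.2 hs).le
  · have := measure_ne_top (divId ν) Set.univ
    rwa [divId, withDensity_apply _ MeasurableSet.univ, Measure.restrict_univ] at this

/-- The normalizing constant of $\widetilde\nu$ cancels against $\|1/s\|_{L^1(\nu)}$. Stated as a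
product, the identity also covers $\nu=0$. -/
lemma invNorm_mul_tilde_apply [IsFiniteMeasure ν] (h : ∀ᵐ s ∂ν, 0 < s) [IsFiniteMeasure (divId ν)]
    {E : Set ℝ}
    (hE : MeasurableSet E) :
    (divId ν).real Set.univ * tilde ν.toSignedMeasure E = (divId ν).real E := by
  have hint := integrable_one_div h
  -- Commutativity of real multiplication rewrites the pairing as flipped scalar multiplication, the
  -- form in which an integral against `toSignedMeasure` becomes an ordinary one.
  have hB : ContinuousLinearMap.mul ℝ ℝ = (ContinuousLinearMap.lsmul ℝ ℝ).flip := by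
    ext
    simp
  have hf : ∀ s, 1 / (s * (divId ν).real Set.univ) = ((divId ν).real Set.univ)⁻¹ * (1 / s) := by
    intro s
    rw [one_div, mul_inv, one_div, mul_comm]
  have hreal : (divId ν).real E = ∫ s in E, 1 / s ∂ν := by
    rw [Measure.real, divId, withDensity_apply _ hE, integral_eq_lintegral_of_nonneg_ae _
      (by fun_prop)]
    exact ae_restrict_of_ae (h.mono fun s hs => (one_div_pos.2 hs).le)
  have hint' : ν.toSignedMeasure.Integrable fun s => 1 / (s * (divId ν).real Set.univ) := by
    rw [VectorMeasure.Integrable, Measure.variation_toSignedMeasure]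
    simp_rw [hf]
    exact hint.const_mul _
  rw [tilde, invNorm_toSignedMeasure h, VectorMeasure.withDensity_apply hint', hB,
    VectorMeasure.setIntegral_toSignedMeasure hE, hreal]
  simp_rw [hf]
  rw [integral_const_mul, ← hreal]
  by_cases h0 : (divId ν).real Set.univ = 0
  · rw [h0, zero_mul, eq_comm]
    exact le_antisymm (h0 ▸ measureReal_mono (Set.subset_univ E)) measureReal_nonneg
  · rw [mul_inv_cancel_left₀ h0]

end

lemma delta0_apply {E : Set ℝ} (hE : MeasurableSet E) :
    delta0 E = (Measure.dirac (0 : ℝ)).real E :=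
  Measure.toSignedMeasure_apply_measurable hE

section

variable {a y₀ : ℝ} {ξx ηy ηy₁ ξ η Ψ Φ : Measure ℝ}

lemma psi_apply [IsFiniteMeasure ηy₁] [IsFiniteMeasure ξ] [IsFiniteMeasure η] (hξ : ∀ᵐ s ∂ξ, 0 < s)
    {E : Set ℝ} (hE : MeasurableSet E) :
    psi a ηy₁.toSignedMeasure ξ.toSignedMeasure η.toSignedMeasure E =
      ηy₁.real E - a ^ 2 * (divId ξ).real Set.univ * η.real E := by
  rw [psi, invNorm_toSignedMeasure hξ]
  simp [hE]

lemma phi_apply [IsFiniteMeasure ξx] [IsFiniteMeasure ξ] [IsFiniteMeasure η]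
    [IsFiniteMeasure (divId ξ)] [IsFiniteMeasure Ψ] (hξ : ∀ᵐ s ∂ξ, 0 < s) (hη : ∀ᵐ s ∂η, 0 < s)
    (hΨ : ∀ᵐ s ∂Ψ, 0 < s) {E : Set ℝ} (hE : MeasurableSet E) :
    phi a y₀ ξx.toSignedMeasure Ψ.toSignedMeasure ξ.toSignedMeasure η.toSignedMeasure E =
      ξx.real E - y₀ ^ 2 * (divId Ψ).real Set.univ * (Measure.dirac (0 : ℝ)).real E -
        a ^ 2 * y₀ ^ 2 * (divId η).real Set.univ * (divId ξ).real E := by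
  rw [phi, invNorm_toSignedMeasure hξ, invNorm_toSignedMeasure hη, invNorm_toSignedMeasure hΨ,
    ← invNorm_mul_tilde_apply hξ hE, ← delta0_apply hE]
  simp only [FunLike.coe_sub, FunLike.coe_smul, Pi.sub_apply, Pi.smul_apply,
    smul_eq_mul, Measure.toSignedMeasure_apply_measurable hE]
  ring

lemma IsAxisDecomposition.vertical_real [IsFiniteMeasure η] [IsFiniteMeasure (divId ξ)]
    [IsFiniteMeasure Ψ]
    (hD : IsAxisDecomposition (ENNReal.ofReal (a ^ 2)) (ENNReal.ofReal (y₀ ^ 2)) ξx ηy₁ ξ η Ψ Φ)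
    (E : Set ℝ) :
    ηy₁.real E = Ψ.real E + a ^ 2 * (divId ξ).real Set.univ * η.real E := by
  conv_lhs => rw [hD.vertical]
  have : IsFiniteMeasure ((ENNReal.ofReal (a ^ 2) * divId ξ Set.univ) • η) :=
    Measure.smul_finite _ (by finiteness)
  rw [measureReal_add_apply, measureReal_ennreal_smul_apply, ENNReal.toReal_mul,
    ENNReal.toReal_ofReal (by positivity)]
  rfl

lemma IsAxisDecomposition.horizontal_real [IsFiniteMeasure (divId ξ)] [IsFiniteMeasure (divId η)]
    [IsFiniteMeasure Φ] [IsFiniteMeasure (divId Ψ)]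
    (hD : IsAxisDecomposition (ENNReal.ofReal (a ^ 2)) (ENNReal.ofReal (y₀ ^ 2)) ξx ηy₁ ξ η Ψ Φ)
    (E : Set ℝ) :
    ξx.real E = Φ.real E + y₀ ^ 2 * (divId Ψ).real Set.univ * (Measure.dirac (0 : ℝ)).real E +
      a ^ 2 * y₀ ^ 2 * (divId η).real Set.univ * (divId ξ).real E := by
  conv_lhs => rw [hD.horizontal]
  have : IsFiniteMeasure ((ENNReal.ofReal (y₀ ^ 2) * divId Ψ Set.univ) •
      Measure.dirac (0 : ℝ)) := Measure.smul_finite _ (by finiteness)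
  have : IsFiniteMeasure ((ENNReal.ofReal (a ^ 2) * ENNReal.ofReal (y₀ ^ 2) *
      divId η Set.univ) • divId ξ) := Measure.smul_finite _ (by finiteness)
  rw [measureReal_add_apply, measureReal_add_apply, measureReal_ennreal_smul_apply,
    measureReal_ennreal_smul_apply, ENNReal.toReal_mul, ENNReal.toReal_mul, ENNReal.toReal_mul,
    ENNReal.toReal_ofReal (by positivity), ENNReal.toReal_ofReal (by positivity)]
  rfl

/-- The signed measures `ψ` and `φ` are the axis parts of an axis decomposition. -/
lemma IsAxisDecomposition.psi_phi_eq [IsFiniteMeasure ξx] [IsFiniteMeasure ηy] [IsFiniteMeasure ηy₁]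
    [IsFiniteMeasure ξ] [IsFiniteMeasure η] [IsFiniteMeasure (divId ξ)] [IsFiniteMeasure (divId η)]
    [IsFiniteMeasure Ψ] [IsFiniteMeasure Φ] (hy₀ : y₀ ≠ 0)
    (hD : IsAxisDecomposition (ENNReal.ofReal (a ^ 2)) (ENNReal.ofReal (y₀ ^ 2)) ξx ηy₁ ξ η Ψ Φ)
    (hξ : ∀ᵐ s ∂ξ, 0 < s) (hη : ∀ᵐ s ∂η, 0 < s)
    (hηy₁ : mulId ηy = ENNReal.ofReal (y₀ ^ 2) • ηy₁) :
    psi a ηy₁.toSignedMeasure ξ.toSignedMeasure η.toSignedMeasure = Ψ.toSignedMeasure ∧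
    phi a y₀ ξx.toSignedMeasure Ψ.toSignedMeasure ξ.toSignedMeasure η.toSignedMeasure =
      Φ.toSignedMeasure := by
  have hY : ENNReal.ofReal (y₀ ^ 2) ≠ 0 := (ENNReal.ofReal_pos.2 (by positivity)).ne'
  have := isFiniteMeasure_divId_of_le hY hηy₁ hD.vertical_le
  have hΨ := pos_of_le hY hηy₁ hD.vertical_le
  constructor <;> ext E hE
  · rw [psi_apply hξ hE, hD.vertical_real, Measure.toSignedMeasure_apply_measurable hE]
    ring
  · rw [phi_apply hξ hη hΨ hE, hD.horizontal_real, Measure.toSignedMeasure_apply_measurable hE]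
    ring

/-- If `ψ` and `φ` are positive, then they give an axis decomposition. -/
lemma exists_axisDecomposition_of_nonneg [IsFiniteMeasure ξx] [IsFiniteMeasure ηy]
    [IsFiniteMeasure ηy₁] [IsFiniteMeasure ξ] [IsFiniteMeasure η] [IsFiniteMeasure (divId ξ)]
    [IsFiniteMeasure (divId η)] (hy₀ : y₀ ≠ 0) (hξ : ∀ᵐ s ∂ξ, 0 < s)
    (hη : ∀ᵐ s ∂η, 0 < s) (hηy₁ : mulId ηy = ENNReal.ofReal (y₀ ^ 2) • ηy₁)
    (hψ : 0 ≤ psi a ηy₁.toSignedMeasure ξ.toSignedMeasure η.toSignedMeasure)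
    (hφ : 0 ≤ phi a y₀ ξx.toSignedMeasure
      (psi a ηy₁.toSignedMeasure ξ.toSignedMeasure η.toSignedMeasure)
      ξ.toSignedMeasure η.toSignedMeasure) :
    ∃ Ψ Φ : Measure ℝ, IsFiniteMeasure Ψ ∧ IsFiniteMeasure Φ ∧
      IsAxisDecomposition (ENNReal.ofReal (a ^ 2)) (ENNReal.ofReal (y₀ ^ 2)) ξx ηy₁ ξ η Ψ Φ := by
  have hY : ENNReal.ofReal (y₀ ^ 2) ≠ 0 := (ENNReal.ofReal_pos.2 (by positivity)).ne'
  obtain ⟨Ψ, _, hΨψ⟩ := exists_toSignedMeasure_eq hψ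
  rw [← hΨψ] at hφ
  obtain ⟨Φ, _, hΦφ⟩ := exists_toSignedMeasure_eq hφ
  have : IsFiniteMeasure ((ENNReal.ofReal (a ^ 2) * divId ξ Set.univ) • η) :=
    Measure.smul_finite _ (by finiteness)
  have hv : ηy₁ = Ψ + (ENNReal.ofReal (a ^ 2) * divId ξ Set.univ) • η := by
    refine ext_of_real fun E hE => ?_
    rw [measureReal_add_apply, measureReal_ennreal_smul_apply, ENNReal.toReal_mul,
      ENNReal.toReal_ofReal (by positivity), ← Measure.toSignedMeasure_apply_measurable (μ := Ψ) hE,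
      hΨψ, psi_apply hξ hE, Measure.real_def (divId ξ)]
    ring
  have hle : Ψ ≤ ηy₁ := by
    rw [hv]
    exact Measure.le_add_right le_rfl
  have := isFiniteMeasure_divId_of_le hY hηy₁ hle
  have hΨ := pos_of_le hY hηy₁ hle
  have : IsFiniteMeasure ((ENNReal.ofReal (y₀ ^ 2) * divId Ψ Set.univ) •
      Measure.dirac (0 : ℝ)) := Measure.smul_finite _ (by finiteness)
  have : IsFiniteMeasure ((ENNReal.ofReal (a ^ 2) * ENNReal.ofReal (y₀ ^ 2) *
      divId η Set.univ) • divId ξ) := Measure.smul_finite _ (by finiteness)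
  refine ⟨Ψ, Φ, inferInstance, inferInstance, hv, ext_of_real fun E hE => ?_⟩
  rw [measureReal_add_apply, measureReal_add_apply, measureReal_ennreal_smul_apply,
    measureReal_ennreal_smul_apply, ENNReal.toReal_mul, ENNReal.toReal_mul, ENNReal.toReal_mul,
    ENNReal.toReal_ofReal (by positivity), ENNReal.toReal_ofReal (by positivity),
    ← Measure.toSignedMeasure_apply_measurable (μ := Φ) hE, hΦφ, phi_apply hξ hη hΨ hE,
    Measure.real_def (divId Ψ) Set.univ, Measure.real_def (divId η) Set.univ]
  ring

/-- On a rectangle $S\times T$ the total coefficient of $\widetilde\eta(T)$ is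
$\xi_x(S)-\varphi(S)-y_0^2\|1/t\|_{L^1(\psi)}\delta_0(S)$. The horizontal decomposition turns this
into $a^2y_0^2\|1/t\|_{L^1(\eta)}\int_S s^{-1}d\xi$, the core term of the glued measure. -/
lemma toSignedMeasure_eq_reconstructed [IsFiniteMeasure ξx] [IsFiniteMeasure ηy] [IsFiniteMeasure η]
    [IsFiniteMeasure (divId ξ)] [IsFiniteMeasure (divId η)] [IsFiniteMeasure Ψ] [IsFiniteMeasure Φ]
    (hy₀ : y₀ ≠ 0)
    (hD : IsAxisDecomposition (ENNReal.ofReal (a ^ 2)) (ENNReal.ofReal (y₀ ^ 2)) ξx ηy₁ ξ η Ψ Φ)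
    (hη : ∀ᵐ s ∂η, 0 < s) (hηy₁ : mulId ηy = ENNReal.ofReal (y₀ ^ 2) • ηy₁)
    {μ : Measure (ℝ × ℝ)} [IsFiniteMeasure μ]
    (hμ : μ = glue (ENNReal.ofReal (a ^ 2)) (ENNReal.ofReal (y₀ ^ 2)) ξ η Ψ Φ) :
    μ.toSignedMeasure =
      reconstructed y₀ Φ.toSignedMeasure Ψ.toSignedMeasure ξx.toSignedMeasure
        η.toSignedMeasure := by
  have hY : ENNReal.ofReal (y₀ ^ 2) ≠ 0 := (ENNReal.ofReal_pos.2 (by positivity)).ne'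
  have := isFiniteMeasure_divId_of_le hY hηy₁ hD.vertical_le
  have hΨ := pos_of_le hY hηy₁ hD.vertical_le
  have hrect : ∀ S T : Set ℝ, MeasurableSet S → MeasurableSet T →
      μ.toSignedMeasure (S ×ˢ T) = reconstructed y₀ Φ.toSignedMeasure Ψ.toSignedMeasure
        ξx.toSignedMeasure η.toSignedMeasure (S ×ˢ T) := by
    intro S T hS hT
    have e1 := invNorm_mul_tilde_apply hΨ hT
    have e2 := invNorm_mul_tilde_apply hη hT
    have e3 := hD.horizontal_real S
    have f1 : IsFiniteMeasure (ENNReal.ofReal (y₀ ^ 2) • divId Ψ) :=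
      Measure.smul_finite _ (by finiteness)
    have f2 : IsFiniteMeasure ((ENNReal.ofReal (a ^ 2) * ENNReal.ofReal (y₀ ^ 2)) •
      (divId ξ).prod (divId η)) := Measure.smul_finite _ (by finiteness)
    have hleft : μ.toSignedMeasure (S ×ˢ T) =
        Φ.real S * (Measure.dirac (0 : ℝ)).real T +
          (Measure.dirac (0 : ℝ)).real S * (y₀ ^ 2 * (divId Ψ).real T) +
            a ^ 2 * y₀ ^ 2 * ((divId ξ).real S * (divId η).real T) := by
      rw [Measure.toSignedMeasure_apply_measurable (hS.prod hT), hμ, glue, measureReal_add_apply,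
        measureReal_add_apply, measureReal_ennreal_smul_apply, measureReal_prod_prod,
        measureReal_prod_prod, measureReal_prod_prod, measureReal_ennreal_smul_apply,
        ENNReal.toReal_mul, ENNReal.toReal_ofReal (by positivity),
        ENNReal.toReal_ofReal (by positivity)]
    have hright : reconstructed y₀ Φ.toSignedMeasure Ψ.toSignedMeasure
        ξx.toSignedMeasure η.toSignedMeasure (S ×ˢ T) =
        Φ.real S * ((Measure.dirac (0 : ℝ)).real T - tilde η.toSignedMeasure T) +
          y₀ ^ 2 * (divId Ψ).real Set.univ * ((Measure.dirac (0 : ℝ)).real S *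
            (tilde Ψ.toSignedMeasure T - tilde η.toSignedMeasure T)) +
          ξx.real S * tilde η.toSignedMeasure T := by
      have : IsFiniteMeasure delta0.variation := by
        unfold delta0
        infer_instance
      simp only [reconstructed, prodMeas, invNorm_toSignedMeasure hΨ, FunLike.coe_add,
        FunLike.coe_sub, FunLike.coe_smul, Pi.add_apply, Pi.sub_apply, Pi.smul_apply,
        smul_eq_mul, VectorMeasure.prod_apply, ContinuousLinearMap.mul_apply', delta0_apply hS,
        delta0_apply hT, Measure.toSignedMeasure_apply_measurable hS]
    rw [hleft, hright, e3]
    linear_combination (-(Measure.dirac (0 : ℝ)).real S * y₀ ^ 2) * e1 -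
      a ^ 2 * y₀ ^ 2 * (divId ξ).real S * e2
  apply VectorMeasure.ext_of_generateFrom _ _ generateFrom_prod.symm isPiSystem_prod
  · rw [← Set.univ_prod_univ]
    exact hrect _ _ MeasurableSet.univ MeasurableSet.univ
  · rintro _ ⟨S, hS, T, hT, rfl⟩
    exact hrect S T hS hT

end

/-! ### Moments of the weight diagram -/

lemma moment_succ (w : ℕ → ℝ) (n : ℕ) :
    moment w (n + 1) = w 0 ^ 2 * moment (fun i => w (i + 1)) n := by
  rw [moment, Finset.prod_range_succ', mul_comm, moment]

section

variable {a : ℝ} {x y α β : ℕ → ℝ}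

lemma horizontalWeight_pos (ha : 0 < a) (hx : ∀ n, 0 < x n) (hy : ∀ n, 0 < y n)
    (hα : ∀ n, 1 ≤ n → 0 < α n) (hβ : ∀ n, 1 ≤ n → 0 < β n) :
    ∀ k, 0 < horizontalWeight a x y α β k
  | (k, 0) => by simpa [horizontalWeight] using hx k
  | (0, l + 1) => by
    rw [horizontalWeight]
    exact mul_pos ha (Finset.prod_pos fun j _ => div_pos (hβ _ (by omega)) (hy _))
  | (k + 1, l + 1) => by
    rw [horizontalWeight]
    exact hα _ (by omega)

lemma verticalWeight_pos (ha : 0 < a) (hx : ∀ n, 0 < x n) (hy : ∀ n, 0 < y n)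
    (hα : ∀ n, 1 ≤ n → 0 < α n) (hβ : ∀ n, 1 ≤ n → 0 < β n) :
    ∀ k, 0 < verticalWeight a x y α β k
  | (0, l) => by simpa [verticalWeight] using hy l
  | (k + 1, 0) => by
    rw [verticalWeight]
    exact mul_pos (div_pos (mul_pos ha (hy 0)) (hx 0))
      (Finset.prod_pos fun j _ => div_pos (hα _ (by omega)) (hx _))
  | (k + 1, l + 1) => by
    rw [verticalWeight]
    exact hβ _ (by omega)

lemma horizontalWeight_zero (k : ℕ) : horizontalWeight a x y α β (k, 0) = x k := by
  cases k <;> rw [horizontalWeight]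

lemma moment₂_fst (k : ℕ) :
    moment₂ (horizontalWeight a x y α β) (verticalWeight a x y α β) (k, 0) = moment x k := by
  simp [moment₂, moment, horizontalWeight_zero]

lemma moment₂_snd (l : ℕ) :
    moment₂ (horizontalWeight a x y α β) (verticalWeight a x y α β) (0, l) = moment y l := by
  simp [moment₂, moment, verticalWeight]

/-- The path runs along the bottom row and collects $x_0,\dots,x_k$. The first vertical weight in
column $k+1$ cancels all of them and leaves $a\,y_0\,\alpha_1\cdots\alpha_k$. -/
lemma moment₂_core (hx : ∀ n, 0 < x n) (k l : ℕ) :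
    moment₂ (horizontalWeight a x y α β) (verticalWeight a x y α β) (k + 1, l + 1) =
      a ^ 2 * y 0 ^ 2 * (moment (fun n => α (n + 1)) k * moment (fun n => β (n + 1)) l) := by
  have h : (∏ i ∈ Finset.range k, x (i + 1) ^ 2) * (∏ i ∈ Finset.range k, α (i + 1) / x (i + 1)) ^ 2
      = ∏ i ∈ Finset.range k, α (i + 1) ^ 2 := by
    rw [← Finset.prod_pow, ← Finset.prod_mul_distrib]
    refine Finset.prod_congr rfl fun i _ => ?_
    have := (hx (i + 1)).ne'
    field_simp
  have h0 := (hx 0).ne'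
  simp only [moment₂, horizontalWeight_zero, moment]
  rw [Finset.prod_range_succ', Finset.prod_range_succ']
  simp only [verticalWeight]
  rw [← h]
  field_simp

/-- The operator norms bound every weight of the diagram, so the one-variable Berger measures are
carried by $[0,\|T_1\|^2]$ or $[0,\|T_2\|^2]$. -/
lemma IsTwoVarShift.abs_weight_le {A B : ℕ × ℕ → ℝ} {T₁ T₂ : Ell2 →L[ℂ] Ell2}
    (h : IsTwoVarShift A B T₁ T₂) (k : ℕ × ℕ) : A k ^ 2 ≤ ‖T₁‖ ^ 2 ∧ B k ^ 2 ≤ ‖T₂‖ ^ 2 := by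
  have h1 := T₁.le_opNorm (e k)
  have h2 := T₂.le_opNorm (e k)
  rw [(h k).1, norm_smul, e_norm, e_norm, mul_one, mul_one, Complex.norm_real,
    Real.norm_eq_abs] at h1
  rw [(h k).2, norm_smul, e_norm, e_norm, mul_one, mul_one, Complex.norm_real,
    Real.norm_eq_abs] at h2
  exact ⟨sq_le_sq' (neg_le_of_abs_le h1) (le_of_abs_le h1),
    sq_le_sq' (neg_le_of_abs_le h2) (le_of_abs_le h2)⟩

end

/-! ### One-variable Berger measures and the moment form of a product core. -/

lemma IsBergerMeasure.ae_mem_Icc {w : ℕ → ℝ} {ν : ProbabilityMeasure ℝ}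
    (h : IsBergerMeasure w ν) {C : ℝ} (hC : ∀ n, w n ^ 2 ≤ C) :
    ∀ᵐ s ∂(ν : Measure ℝ), s ∈ Set.Icc 0 C := by
  have h1 : ∀ᵐ s ∂(ν : Measure ℝ), s ∈ Set.Icc 0 (⨆ n, w n ^ 2) := h.1
  filter_upwards [h1] with s hs
  exact ⟨hs.1, hs.2.trans (ciSup_le hC)⟩

/-- Shifting the weights multiplies the Berger measure by the coordinate. -/
lemma IsBergerMeasure.mulId_eq {w : ℕ → ℝ} {ν ν₁ : ProbabilityMeasure ℝ}
    (h : IsBergerMeasure w ν) (h₁ : IsBergerMeasure (fun n => w (n + 1)) ν₁) {C : ℝ}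
    (hC : ∀ n, w n ^ 2 ≤ C) :
    mulId (ν : Measure ℝ) = ENNReal.ofReal (w 0 ^ 2) • (ν₁ : Measure ℝ) := by
  have s := h.ae_mem_Icc hC
  have s₁ := h₁.ae_mem_Icc fun n => hC (n + 1)
  have := isFiniteMeasure_mulId (.of_Icc s)
  have : IsFiniteMeasure (ENNReal.ofReal (w 0 ^ 2) • (ν₁ : Measure ℝ)) :=
    Measure.smul_finite _ (by finiteness)
  refine ext_of_integral_pow ((BddSupport.of_Icc s).mono (mulId_absolutelyContinuous _))
    ((BddSupport.of_Icc s₁).smul _) fun n => ?_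
  rw [integral_pow_mulId (s.mono fun _ h => h.1), integral_smul_measure, ← h.2, ← h₁.2,
    moment_succ, ENNReal.toReal_ofReal (by positivity), smul_eq_mul]

/-- Since `1 / 0 = 0`, integrability alone would allow an atom at the origin; the first component of
`InvIntegrable` excludes it. -/
lemma InvIntegrable.ae_pos {ν : Measure ℝ} (h : InvIntegrable ν) (h0 : ∀ᵐ s ∂ν, 0 ≤ s) :
    ∀ᵐ s ∂ν, 0 < s := by
  have h1 : ∀ᵐ s ∂ν, s ≠ 0 := by
    rw [ae_iff]
    simpa using h.1
  filter_upwards [h0, h1] with s hs hs'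
  exact lt_of_le_of_ne hs hs'.symm

lemma InvIntegrable.isFiniteMeasure_divId {ν : Measure ℝ} (h : InvIntegrable ν) :
    IsFiniteMeasure (divId ν) :=
  isFiniteMeasure_withDensity_ofReal h.2.2

/-- Moments of a 2-variable weighted shift with weights given by the diagram are the moments of a
measure with product core. -/
lemma hasProductCore_iff {a : ℝ} {x y α β : ℕ → ℝ} (hx : ∀ n, 0 < x n)
    {ξx ηy ξ η : ProbabilityMeasure ℝ} (hξx : IsBergerMeasure x ξx) (hηy : IsBergerMeasure y ηy)
    (hξ : IsBergerMeasure (fun n => α (n + 1)) ξ) (hη : IsBergerMeasure (fun n => β (n + 1)) η)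
    {C : ℝ} (cx : ∀ n, x n ^ 2 ≤ C) (cy : ∀ n, y n ^ 2 ≤ C)
    (cα : ∀ n, α (n + 1) ^ 2 ≤ C) (cβ : ∀ n, β (n + 1) ^ 2 ≤ C)
    {μ : Measure (ℝ × ℝ)} [IsFiniteMeasure μ] (hμ : BddSupport μ) :
    HasProductCore μ (ENNReal.ofReal (a ^ 2) * ENNReal.ofReal (y 0 ^ 2)) ξx ηy ξ η ↔
      ∀ k : ℕ × ℕ, moment₂ (horizontalWeight a x y α β) (verticalWeight a x y α β) k =
        ∫ p, p.1 ^ k.1 * p.2 ^ k.2 ∂μ := by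
  have sx := hξx.ae_mem_Icc cx
  have sy := hηy.ae_mem_Icc cy
  have sξ := hξ.ae_mem_Icc cα
  have sη := hη.ae_mem_Icc cβ
  have hc : (ENNReal.ofReal (a ^ 2) * ENNReal.ofReal (y 0 ^ 2)).toReal = a ^ 2 * y 0 ^ 2 := by
    rw [ENNReal.toReal_mul, ENNReal.toReal_ofReal (by positivity),
      ENNReal.toReal_ofReal (by positivity)]
  constructor
  · intro h
    obtain ⟨h₁, h₂, h₃⟩ := h.integral_eq (sx.mono fun _ h => h.1) (sy.mono fun _ h => h.1)
    rintro ⟨_ | k, _ | l⟩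
    · rw [moment₂_fst, hξx.2]
      simpa using (h₁ 0).symm
    · rw [moment₂_snd, hηy.2]
      simpa using (h₂ (l + 1)).symm
    · rw [moment₂_fst, hξx.2]
      simpa using (h₁ (k + 1)).symm
    · rw [moment₂_core hx, hξ.2, hη.2, h₃, hc]
  · intro h
    refine .of_integral_eq (by finiteness) hμ (.of_Icc sx) (.of_Icc sy) (.of_Icc sξ) (.of_Icc sη)
      (sx.mono fun _ h => h.1) (sy.mono fun _ h => h.1) (fun k => ?_) (fun l => ?_)
      fun k l => ?_
    · rw [← hξx.2, ← moment₂_fst (a := a) (y := y) (α := α) (β := β), h]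
      simp
    · rw [← hηy.2, ← moment₂_snd (a := a) (x := x) (α := α) (β := β), h]
      simp
    · rw [hc, ← hξ.2, ← hη.2, ← moment₂_core hx, h]

end BergerTC

end

/-! ### Subnormality, positivity of the axis parts and the reconstruction formula. -/

theorem theorem2p3
    (a : ℝ) (x y α β : ℕ → ℝ)
    (ha : 0 < a) (hx : ∀ n, 0 < x n) (hy : ∀ n, 0 < y n)
    (hα : ∀ n, 1 ≤ n → 0 < α n) (hβ : ∀ n, 1 ≤ n → 0 < β n)
    (T₁ T₂ : BergerTC.Ell2 →L[ℂ] BergerTC.Ell2)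
    (hT : BergerTC.IsTwoVarShift (BergerTC.horizontalWeight a x y α β)
      (BergerTC.verticalWeight a x y α β) T₁ T₂)
    (hH₀ : BergerTC.IsCommutingPairOfSubnormals T₁ T₂)
    (ξx ηy ηy₁ ξ η : ProbabilityMeasure ℝ)
    (hξx : BergerTC.IsBergerMeasure x ξx)
    (hηy : BergerTC.IsBergerMeasure y ηy)
    (hηy₁ : BergerTC.IsBergerMeasure (fun n => y (n + 1)) ηy₁)
    (hξ : BergerTC.IsBergerMeasure (fun n => α (n + 1)) ξ)
    (hη : BergerTC.IsBergerMeasure (fun n => β (n + 1)) η)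
    (hξinv : BergerTC.InvIntegrable ξ) (hηinv : BergerTC.InvIntegrable η)
    (ψ φ : SignedMeasure ℝ)
    (hψ : ψ = BergerTC.psi a (BergerTC.signed ηy₁) (BergerTC.signed ξ) (BergerTC.signed η))
    (hφ : φ = BergerTC.phi a (y 0) (BergerTC.signed ξx) ψ (BergerTC.signed ξ)
      (BergerTC.signed η)) :
    (BergerTC.IsSubnormalPair T₁ T₂ ↔ 0 ≤ ψ ∧ 0 ≤ φ) ∧
    (BergerTC.IsSubnormalPair T₁ T₂ →
      (∃ μ : ProbabilityMeasure (ℝ × ℝ),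
        BergerTC.IsBergerMeasure₂ (BergerTC.horizontalWeight a x y α β)
          (BergerTC.verticalWeight a x y α β) T₁ T₂ μ) ∧
      ∀ μ : ProbabilityMeasure (ℝ × ℝ),
        BergerTC.IsBergerMeasure₂ (BergerTC.horizontalWeight a x y α β)
          (BergerTC.verticalWeight a x y α β) T₁ T₂ μ →
        BergerTC.signed μ = BergerTC.reconstructed (y 0) φ ψ (BergerTC.signed ξx)
          (BergerTC.signed η)) := by
  have hy₀ : y 0 ≠ 0 := (hy 0).ne'
  have hY : ENNReal.ofReal (y 0 ^ 2) ≠ 0 := (ENNReal.ofReal_pos.2 (by positivity)).ne'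
  have bx : ∀ n, x n ^ 2 ≤ ‖T₁‖ ^ 2 := fun n => by
    simpa [BergerTC.horizontalWeight_zero] using (hT.abs_weight_le (n, 0)).1
  have by' : ∀ n, y n ^ 2 ≤ ‖T₂‖ ^ 2 := fun n => by
    simpa [BergerTC.verticalWeight] using (hT.abs_weight_le (0, n)).2
  have bα : ∀ n, α (n + 1) ^ 2 ≤ ‖T₁‖ ^ 2 := fun n => by
    simpa [BergerTC.horizontalWeight] using (hT.abs_weight_le (n + 1, 1)).1
  have bβ : ∀ n, β (n + 1) ^ 2 ≤ ‖T₂‖ ^ 2 := fun n => by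
    simpa [BergerTC.verticalWeight] using (hT.abs_weight_le (1, n + 1)).2
  have sx := hξx.ae_mem_Icc bx
  have sy := hηy.ae_mem_Icc by'
  have hξ0 := hξinv.ae_pos ((hξ.ae_mem_Icc bα).mono fun _ h => h.1)
  have hη0 := hηinv.ae_pos ((hη.ae_mem_Icc bβ).mono fun _ h => h.1)
  have := hξinv.isFiniteMeasure_divId
  have := hηinv.isFiniteMeasure_divId
  have hmul := hηy.mulId_eq hηy₁ by'
  have hcore : ∀ (μ : Measure (ℝ × ℝ)) [IsFiniteMeasure μ], BergerTC.BddSupport μ → _ :=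
    fun μ _ hμ => BergerTC.hasProductCore_iff (a := a) hx hξx hηy hξ hη
      (fun n => (bx n).trans (le_max_left _ _)) (fun n => (by' n).trans (le_max_right _ _))
      (fun n => (bα n).trans (le_max_left _ _)) (fun n => (bβ n).trans (le_max_right _ _)) hμ
  have bdd : ∀ μ : Measure (ℝ × ℝ),
      μ (Set.Icc 0 (‖T₁‖ ^ 2) ×ˢ Set.Icc 0 (‖T₂‖ ^ 2))ᶜ = 0 → BergerTC.BddSupport μ := by
    intro μ hμ
    have h : ∀ᵐ p ∂μ, p ∈ Set.Icc 0 (‖T₁‖ ^ 2) ×ˢ Set.Icc 0 (‖T₂‖ ^ 2) := hμ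
    refine ⟨max (‖T₁‖ ^ 2) (‖T₂‖ ^ 2), ?_⟩
    filter_upwards [h] with p hp
    refine max_le_max ?_ ?_
    · rw [Real.norm_of_nonneg hp.1.1]
      exact hp.1.2
    · rw [Real.norm_of_nonneg hp.2.1]
      exact hp.2.2
  have of_subnormal : BergerTC.IsSubnormalPair T₁ T₂ → ∃ Ψ Φ : Measure ℝ,
      BergerTC.IsAxisDecomposition (ENNReal.ofReal (a ^ 2)) (ENNReal.ofReal (y 0 ^ 2))
        ξx ηy₁ ξ η Ψ Φ := by
    intro hs
    -- Only boundedness of the support is recorded here; that `μ` lives on the closed quadrant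
    -- follows once its marginals are identified.
    obtain ⟨μ, R, _, hR, hmom⟩ := hs.exists_measure hT
    have hμ : BergerTC.BddSupport μ := by
      have h : ∀ᵐ p ∂μ, p ∈ Metric.closedBall 0 R := hR
      exact ⟨R, h.mono fun p hp => by simpa using hp⟩
    exact ((hcore μ hμ).2 hmom).exists_axisDecomposition hY ENNReal.ofReal_ne_top
      (sx.mono fun _ h => h.1) hη0 hmul
  have of_nonneg : 0 ≤ ψ ∧ 0 ≤ φ → ∃ Ψ Φ : Measure ℝ,
      BergerTC.IsAxisDecomposition (ENNReal.ofReal (a ^ 2)) (ENNReal.ofReal (y 0 ^ 2))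
        ξx ηy₁ ξ η Ψ Φ := by
    rintro ⟨h1, h2⟩
    rw [hφ, hψ] at h2
    rw [hψ] at h1
    obtain ⟨Ψ, Φ, -, -, hD⟩ :=
      BergerTC.exists_axisDecomposition_of_nonneg hy₀ hξ0 hη0 hmul h1 h2
    exact ⟨Ψ, Φ, hD⟩
  -- An axis decomposition is the common meeting point: subnormality and positivity each produce
  -- one, and one decomposition yields positivity, subnormality and a Berger measure with the stated
  -- formula.
  have of_decomposition : (∃ Ψ Φ : Measure ℝ,
      BergerTC.IsAxisDecomposition (ENNReal.ofReal (a ^ 2)) (ENNReal.ofReal (y 0 ^ 2))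
        ξx ηy₁ ξ η Ψ Φ) → (0 ≤ ψ ∧ 0 ≤ φ) ∧ BergerTC.IsSubnormalPair T₁ T₂ ∧
      ∃ μ : ProbabilityMeasure (ℝ × ℝ),
        BergerTC.IsBergerMeasure₂ (BergerTC.horizontalWeight a x y α β)
          (BergerTC.verticalWeight a x y α β) T₁ T₂ μ ∧
        BergerTC.signed μ = BergerTC.reconstructed (y 0) φ ψ (BergerTC.signed ξx)
          (BergerTC.signed η) := by
    rintro ⟨Ψ, Φ, hD⟩
    have : IsFiniteMeasure Ψ := isFiniteMeasure_of_le _ hD.vertical_le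
    have : IsFiniteMeasure Φ := isFiniteMeasure_of_le _ hD.horizontal_le
    obtain ⟨hΨ, hΦ⟩ := hD.psi_phi_eq hy₀ hξ0 hη0 hmul
    replace hΨ : ψ = Ψ.toSignedMeasure := hψ.trans hΨ
    replace hΦ : φ = Φ.toSignedMeasure := by
      rw [hφ, hΨ]
      exact hΦ
    have hglue := hD.hasProductCore_glue hY hξ0 hη0 hmul (sq_nonneg ‖T₂‖) sy
      (hηy₁.ae_mem_Icc fun n => by' (n + 1)) (hη.ae_mem_Icc bβ)
    obtain ⟨μ, hμ⟩ : ∃ μ, μ = BergerTC.glue (ENNReal.ofReal (a ^ 2)) (ENNReal.ofReal (y 0 ^ 2))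
      ξ η Ψ Φ := ⟨_, rfl⟩
    rw [← hμ] at hglue
    have hprob : IsProbabilityMeasure μ := ⟨by
      rw [← Set.preimage_univ (f := Prod.fst),
        ← Measure.map_apply measurable_fst MeasurableSet.univ, hglue.fst_eq, measure_univ]⟩
    have hsupp : ∀ᵐ p ∂μ, p ∈ Set.Icc 0 (‖T₁‖ ^ 2) ×ˢ Set.Icc 0 (‖T₂‖ ^ 2) := by
      have s₁ := sx
      have s₂ := sy
      rw [← hglue.fst_eq] at s₁
      rw [← hglue.snd_eq] at s₂
      exact (ae_of_ae_map (by fun_prop) s₁).and (ae_of_ae_map (by fun_prop) s₂)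
    have hmom := (hcore μ (bdd μ hsupp)).1 hglue
    refine ⟨⟨?_, ?_⟩, ?_, ⟨μ, hprob⟩, ⟨hsupp, hmom⟩, ?_⟩
    · rw [hΨ]
      exact Measure.zero_le_toSignedMeasure _
    · rw [hΦ]
      exact Measure.zero_le_toSignedMeasure _
    · refine BergerTC.isSubnormalPair_of_measure (BergerTC.horizontalWeight_pos ha hx hy hα hβ)
        (BergerTC.verticalWeight_pos ha hx hy hα hβ) hT hH₀.1 (μ := μ)
        (R := max (‖T₁‖ ^ 2) (‖T₂‖ ^ 2)) ?_ hmom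
      refine measure_mono_null (Set.compl_subset_compl.2 (Set.prod_mono ?_ ?_)) hsupp
      exacts [Set.Icc_subset_Icc_right (le_max_left _ _),
        Set.Icc_subset_Icc_right (le_max_right _ _)]
    · rw [hΨ, hΦ]
      change μ.toSignedMeasure = _
      exact BergerTC.toSignedMeasure_eq_reconstructed hy₀ hD hη0 hmul hμ
  refine ⟨⟨fun h => (of_decomposition (of_subnormal h)).1,
    fun h => (of_decomposition (of_nonneg h)).2.1⟩, fun h => ?_⟩
  obtain ⟨μ, hμ, hrec⟩ := (of_decomposition (of_subnormal h)).2.2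
  refine ⟨⟨μ, hμ⟩, fun ρ hρ => ?_⟩
  -- Both measures have bounded support and the same moments, so the formula proved for the glued
  -- measure holds for every Berger measure.
  have hρμ : (ρ : Measure (ℝ × ℝ)) = μ :=
    BergerTC.ext_of_integral_pow_mul_pow (bdd _ hρ.1) (bdd _ hμ.1)
      fun k l => (hρ.2 (k, l)).symm.trans (hμ.2 (k, l))
  rw [← hrec, Subtype.ext hρμ]
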